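/- Let $\mathcal H$ be a complex Hilbert space (of arbitrary dimension), let $B$ be a bounded operator on $\mathcal H$, and let $-1\le p\le 1$, $p\neq 0$. Then the map $$A\mapsto \operatorname{tr}\,(B^*A^pB)^{1/p}\in[0,\infty]$$ on bounded non-negative operators $A$ on $\mathcal H$ is concave: for all bounded $A_0,A_1\ge 0$ and all $s,t\ge 0$ with $s+t=1$, $$ s\operatorname{tr}(B^*A_0^pB)^{1/p}+t\operatorname{tr}(B^*A_1^pB)^{1/p}\le \operatorname{tr}\bigl(B^*(sA_0+tA_1)^pB\bigr)^{1/p}$$ (with $0\cdot\infty=0$). Here, for $p>0$, powers are given by the continuous functional calculus and $\operatorname{tr}T=\sum_i\langle e_i,Te_i\rangle\in[0,\infty]$ for $T\ge 0$, where $(e_i)$ is an arbitrary orthonormal basis. For $p<0$, the possibly unbounded operator $B^*A^pB$ is given by the $[0,\infty]$-valued quadratic form $Q(x)=\langle Bx,A^pBx\rangle:=\sup_{\varepsilon>0}\langle Bx,(A+\varepsilon)^pBx\rangle$, and $\operatorname{tr}(B^*A^pB)^{1/p}:=\sum_{n\ge 1}\mu_n^{1/p}$, where $\mu_n=\inf_{\dim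 V=n}\ \sup_{x\in V,\|x\|=1}Q(x)\in[0,\infty]$ are its min-max values (its eigenvalues from below, counted with multiplicity, when its spectrum is discrete), with the conventions $0^{1/p}=\infty$ and $\infty^{1/p}=0$. Moreover, if $\mathcal H$ is finite-dimensional, then the real-valued function $A\mapsto\operatorname{tr}(B^*A^pB)^{1/p}$, with the ordinary trace and spectral powers, is concave on the strictly positive (i.e. positive definite) operators $A$; for $p<0$ and $B$ not invertible the power $1/p$ is here taken on the range of $B^*A^pB$, and is $0$ on its kernel. -/

import Mathlib

open scoped ENNReal InnerProductSpace

/-- The trace `∑ᵢ ⟨eᵢ, T eᵢ⟩ ∈ [0, ∞]` of a bounded non-negative operator `T`, computed in the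
orthonormal (Hilbert) basis `e`. -/
noncomputable def posTrace {H : Type*} [NormedAddCommGroup H] [InnerProductSpace ℂ H]
    {ι : Type*} (e : HilbertBasis ι ℂ H) (T : H →L[ℂ] H) : ℝ≥0∞ :=
  ∑' i, ENNReal.ofReal (⟪e i, T (e i)⟫_ℂ).re

/-- For `p < 0` and a bounded `A ≥ 0`: the (closed, `[0, ∞]`-valued) quadratic form
`x ↦ ⟨x, A ^ p x⟩ = sup_{ε > 0} ⟨x, (A + ε) ^ p x⟩` of the possibly unbounded operator `A ^ p`,
understood to be `∞` where `x` is not in the form domain (in particular for `x ∈ ker A`, `x ≠ 0`).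
The expression under the supremum increases as `ε` decreases to `0`. -/
noncomputable def negPowForm {H : Type*} [NormedAddCommGroup H] [InnerProductSpace ℂ H]
    [CompleteSpace H] (A : H →L[ℂ] H) (p : ℝ) (x : H) : ℝ≥0∞ :=
  ⨆ (ε : ℝ) (_ : 0 < ε), ENNReal.ofReal (⟪x, ((A + ε • 1) ^ p : H →L[ℂ] H) x⟫_ℂ).re

/-- The `(n+1)`-st eigenvalue from below (with multiplicity) of the non-negative self-adjoint
operator with quadratic form `Q`, by the min-max principle: the infimum over all
`(n+1)`-dimensional subspaces `V` of the supremum of `Q` over the unit sphere of `V`. It is the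
bottom of the essential spectrum when there are at most `n` eigenvalues below that bottom,
and it is `∞` when the form domain has dimension at most `n`. -/
noncomputable def minMaxValue {H : Type*} [NormedAddCommGroup H] [InnerProductSpace ℂ H]
    (Q : H → ℝ≥0∞) (n : ℕ) : ℝ≥0∞ :=
  ⨅ (V : Submodule ℂ H) (_ : Module.finrank ℂ V = n + 1),
    ⨆ (x : H) (_ : x ∈ V) (_ : ‖x‖ = 1), Q x

/-- For `r < 0`: the trace in `[0, ∞]` of the `r`-th power of the non-negative self-adjoint operator
with quadratic form `Q`, with `0 ^ r = ∞` and `∞ ^ r = 0`. -/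
noncomputable def negPowTrace {H : Type*} [NormedAddCommGroup H] [InnerProductSpace ℂ H]
    (Q : H → ℝ≥0∞) (r : ℝ) : ℝ≥0∞ :=
  ∑' n : ℕ, minMaxValue Q n ^ r

/-- `tr (B* A ^ p B) ^ (1 / p) ∈ [0, ∞]` for bounded operators `A ≥ 0` and `B`, and `p ≠ 0`.
For `p > 0` all operators are bounded and the powers are those of the continuous functional
calculus. For `p < 0` the operator `B* A ^ p B` is the one given by the quadratic form
`x ↦ ⟨B x, A ^ p B x⟩`. -/
noncomputable def sandwichTrace {H : Type*} [NormedAddCommGroup H] [InnerProductSpace ℂ H]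
    [CompleteSpace H] {ι : Type*} (e : HilbertBasis ι ℂ H) (B : H →L[ℂ] H) (p : ℝ)
    (A : H →L[ℂ] H) : ℝ≥0∞ :=
  if 0 < p then
    posTrace e ((ContinuousLinearMap.adjoint B * A ^ p * B) ^ (1 / p))
  else
    negPowTrace (fun x => negPowForm A p (B x)) (1 / p)

/-! ### Basis-independent traces and joint concavity from a variational formula. -/

section HilbertSchmidt

variable {H : Type*} [NormedAddCommGroup H] [InnerProductSpace ℂ H] [CompleteSpace H]
variable {K : Type*} [NormedAddCommGroup K] [InnerProductSpace ℂ K] [FiniteDimensional ℂ K]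

/-! On a finite-dimensional space, Young's inequality and diagonalization give `tr X^(1/p) = max
over Z ≥ 0 of (1/p) tr X Z^(1-p) + (1 - 1/p) tr Z`, attained at `Z = X^(1/p)` (for `p < 0`, when `X`
is invertible). With `X = B* A^p B` the right side is jointly concave in `(A, Z)`, and maximizing a
jointly concave function over `Z` leaves a concave function of `A`. Joint concavity is
`sum_youngFun_concave`; the upper bound by the trace is `sum_youngFun_le_sum_rpow`.

Joint concavity is Lieb's theorem for `0 < p < 1` and Ando's convexity theorem for `-1 ≤ p < 0`,
where the factor `1/p < 0` reverses the sign. For `0 < |p| < 1` the power is an integral of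
resolvents, and each integrand is a minimum over linear maps `K → H` of expressions linear in `(A,
Z)`; a minimum of such expressions is concave. Here `Z` lives on a finite-dimensional `K`, while `A`
acts on an arbitrary `H`.

For `p > 0` in infinite dimension, a finite part of the traces at `A₀` and `A₁` is captured by
compressions to a finite-dimensional `K` (`exists_submodule_sum_re_inner_rpow_le`); the return to
`H` uses the operator Young inequality and Bessel's inequality.

For `p < 0`, `K` is spanned by orthonormal vectors that nearly realize the min-max values for `A₀`
and `A₁`. Concavity is applied to `A + ε` and `ε → 0`. Eigenvalues on `K` dominate min-max values,
so negative powers compare in the right direction. If `B` is not injective the right side is `∞`. In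
the real-valued statement the kernel of `B* A^p B` is `ker B` for every `A > 0`, so it can be split
off. -/

lemma sum_inner_eq_trace_adjoint_comp {ι : Type*} [Fintype ι] [CompleteSpace K]
    (b : OrthonormalBasis ι ℂ K) (M N : K →ₗ[ℂ] H) :
    ∑ i, ⟪M (b i), N (b i)⟫_ℂ = LinearMap.trace ℂ K
      ((ContinuousLinearMap.adjoint (LinearMap.toContinuousLinearMap M)).toLinearMap ∘ₗ N) := by
  rw [LinearMap.trace_eq_sum_inner _ b]
  refine Finset.sum_congr rfl fun i _ => ?_
  simp [ContinuousLinearMap.adjoint_inner_right]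

/-- The real part of `∑ᵢ ⟨M bᵢ, N bᵢ⟩` does not depend on the orthonormal basis `b`. -/
lemma sum_re_inner_orthonormalBasis_eq {ι κ : Type*} [Fintype ι] [Fintype κ]
    (b : OrthonormalBasis ι ℂ K) (c : OrthonormalBasis κ ℂ K) (M N : K →ₗ[ℂ] H) :
    ∑ i, (⟪M (b i), N (b i)⟫_ℂ).re = ∑ k, (⟪M (c k), N (c k)⟫_ℂ).re := by
  have : CompleteSpace K := FiniteDimensional.complete ℂ K
  rw [← Complex.re_sum, ← Complex.re_sum, sum_inner_eq_trace_adjoint_comp b,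
    sum_inner_eq_trace_adjoint_comp c]

omit [CompleteSpace H] [FiniteDimensional ℂ K] in
lemma sum_mul_re_inner_of_eigenbasis {ι : Type*} [Fintype ι] (b : OrthonormalBasis ι ℂ K)
    {Z : K →ₗ[ℂ] K} {u : ι → ℝ} (hu : ∀ i, Z (b i) = (u i : ℂ) • b i) (M N : K →ₗ[ℂ] H) :
    ∑ i, u i * (⟪M (b i), N (b i)⟫_ℂ).re = ∑ i, (⟪M (b i), (N ∘ₗ Z) (b i)⟫_ℂ).re := by
  refine Finset.sum_congr rfl fun i _ => ?_
  simp [hu]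

/-- A weighted sum of eigenvalues along eigenbases depends linearly on the operator. -/
lemma sum_re_inner_eigenbasis_add {ι κ₀ κ₁ : Type*} [Fintype ι] [Fintype κ₀] [Fintype κ₁]
    (b : OrthonormalBasis ι ℂ K) (b₀ : OrthonormalBasis κ₀ ℂ K) (b₁ : OrthonormalBasis κ₁ ℂ K)
    {Z Z₀ Z₁ : K →ₗ[ℂ] K} {u : ι → ℝ} {u₀ : κ₀ → ℝ} {u₁ : κ₁ → ℝ} {s t : ℝ}
    (hu : ∀ i, Z (b i) = (u i : ℂ) • b i) (hu₀ : ∀ i, Z₀ (b₀ i) = (u₀ i : ℂ) • b₀ i)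
    (hu₁ : ∀ i, Z₁ (b₁ i) = (u₁ i : ℂ) • b₁ i) (hZ : Z = (s : ℂ) • Z₀ + (t : ℂ) • Z₁)
    (M N : K →ₗ[ℂ] H) :
    ∑ i, u i * (⟪M (b i), N (b i)⟫_ℂ).re =
      s * ∑ i, u₀ i * (⟪M (b₀ i), N (b₀ i)⟫_ℂ).re +
      t * ∑ i, u₁ i * (⟪M (b₁ i), N (b₁ i)⟫_ℂ).re := by
  rw [sum_mul_re_inner_of_eigenbasis b hu, sum_mul_re_inner_of_eigenbasis b₀ hu₀,
    sum_mul_re_inner_of_eigenbasis b₁ hu₁, sum_re_inner_orthonormalBasis_eq b₀ b,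
    sum_re_inner_orthonormalBasis_eq b₁ b, Finset.mul_sum, Finset.mul_sum, ← Finset.sum_add_distrib]
  refine Finset.sum_congr rfl fun i _ => ?_
  simp [hZ]

/-- If `F A u ξ` is the minimum over `η` of expressions that are linear in `(A, u)` and quadratic
in the vectors, then `(A, Z) ↦ ∑ⱼ F A uⱼ (B gⱼ)`, with `(gⱼ, uⱼ)` the spectral decomposition of
`Z`, is jointly concave. -/
lemma jointly_concave_of_variational {ι κ₀ κ₁ : Type*} [Fintype ι] [Fintype κ₀] [Fintype κ₁]
    (b : OrthonormalBasis ι ℂ K) (b₀ : OrthonormalBasis κ₀ ℂ K) (b₁ : OrthonormalBasis κ₁ ℂ K)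
    {Z Z₀ Z₁ : K →ₗ[ℂ] K} {u : ι → ℝ} {u₀ : κ₀ → ℝ} {u₁ : κ₁ → ℝ} {s t : ℝ}
    (hu : ∀ i, Z (b i) = (u i : ℂ) • b i) (hu₀ : ∀ i, Z₀ (b₀ i) = (u₀ i : ℂ) • b₀ i)
    (hu₁ : ∀ i, Z₁ (b₁ i) = (u₁ i : ℂ) • b₁ i) (hZ : Z = (s : ℂ) • Z₀ + (t : ℂ) • Z₁)
    (hs : 0 ≤ s) (ht : 0 ≤ t)
    (B : K →ₗ[ℂ] H) {A A₀ A₁ : H →L[ℂ] H} (hA : A = s • A₀ + t • A₁)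
    (F : (H →L[ℂ] H) → ℝ → H → ℝ) (c₁ c₂ c₃ : ℝ) (a : ℂ)
    (hF : ∀ i, ∃ η, c₁ * (u i * (⟪η, η⟫_ℂ).re)
      + c₂ * (⟪a • B (b i) - η, A (a • B (b i) - η)⟫_ℂ).re
      - c₃ * (u i * (⟪η, B (b i)⟫_ℂ).re) ≤ F A (u i) (B (b i)))
    (hF₀ : ∀ i ξ η, F A₀ (u₀ i) ξ ≤ c₁ * (u₀ i * (⟪η, η⟫_ℂ).re)
      + c₂ * (⟪a • ξ - η, A₀ (a • ξ - η)⟫_ℂ).re - c₃ * (u₀ i * (⟪η, ξ⟫_ℂ).re))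
    (hF₁ : ∀ i ξ η, F A₁ (u₁ i) ξ ≤ c₁ * (u₁ i * (⟪η, η⟫_ℂ).re)
      + c₂ * (⟪a • ξ - η, A₁ (a • ξ - η)⟫_ℂ).re - c₃ * (u₁ i * (⟪η, ξ⟫_ℂ).re)) :
    s * ∑ i, F A₀ (u₀ i) (B (b₀ i)) + t * ∑ i, F A₁ (u₁ i) (B (b₁ i)) ≤
      ∑ i, F A (u i) (B (b i)) := by
  choose η hη using hF
  -- The minimizers at the eigenvectors of `Z` extend to one linear map, used as a competitor in the
  -- eigenbases of `Z₀` and `Z₁`. All sums become traces linear in `(A, Z)`.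
  set x : K →ₗ[ℂ] H := b.toBasis.constr ℂ η with hx
  have hxb : ∀ i, x (b i) = η i := by
    intro i
    rw [hx, ← b.coe_toBasis, b.toBasis.constr_basis]
  set y : K →ₗ[ℂ] H := a • B - x with hy
  have hyv : ∀ v, a • B v - x v = y v := fun v => by simp [hy]
  have h₀ : ∑ i, F A₀ (u₀ i) (B (b₀ i)) ≤ c₁ * ∑ i, u₀ i * (⟪x (b₀ i), x (b₀ i)⟫_ℂ).re
      + c₂ * ∑ i, (⟪y (b₀ i), A₀ (y (b₀ i))⟫_ℂ).re
      - c₃ * ∑ i, u₀ i * (⟪x (b₀ i), B (b₀ i)⟫_ℂ).re := by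
    simp only [Finset.mul_sum, ← Finset.sum_add_distrib, ← Finset.sum_sub_distrib]
    refine Finset.sum_le_sum fun i _ => ?_
    simpa only [hyv] using hF₀ i (B (b₀ i)) (x (b₀ i))
  have h₁ : ∑ i, F A₁ (u₁ i) (B (b₁ i)) ≤ c₁ * ∑ i, u₁ i * (⟪x (b₁ i), x (b₁ i)⟫_ℂ).re
      + c₂ * ∑ i, (⟪y (b₁ i), A₁ (y (b₁ i))⟫_ℂ).re
      - c₃ * ∑ i, u₁ i * (⟪x (b₁ i), B (b₁ i)⟫_ℂ).re := by
    simp only [Finset.mul_sum, ← Finset.sum_add_distrib, ← Finset.sum_sub_distrib]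
    refine Finset.sum_le_sum fun i _ => ?_
    simpa only [hyv] using hF₁ i (B (b₁ i)) (x (b₁ i))
  have h : c₁ * ∑ i, u i * (⟪x (b i), x (b i)⟫_ℂ).re
      + c₂ * ∑ i, (⟪y (b i), A (y (b i))⟫_ℂ).re
      - c₃ * ∑ i, u i * (⟪x (b i), B (b i)⟫_ℂ).re ≤ ∑ i, F A (u i) (B (b i)) := by
    simp only [Finset.mul_sum, ← Finset.sum_add_distrib, ← Finset.sum_sub_distrib]
    refine Finset.sum_le_sum fun i _ => ?_
    simpa only [← hyv, hxb] using hη i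
  have e₁ := sum_re_inner_eigenbasis_add b b₀ b₁ hu hu₀ hu₁ hZ x x
  have e₃ := sum_re_inner_eigenbasis_add b b₀ b₁ hu hu₀ hu₁ hZ x B
  have e₂ : ∑ i, (⟪y (b i), A (y (b i))⟫_ℂ).re =
      s * ∑ i, (⟪y (b₀ i), A₀ (y (b₀ i))⟫_ℂ).re + t * ∑ i, (⟪y (b₁ i), A₁ (y (b₁ i))⟫_ℂ).re := by
    have r₀ := sum_re_inner_orthonormalBasis_eq b₀ b y (A₀.toLinearMap ∘ₗ y)
    have r₁ := sum_re_inner_orthonormalBasis_eq b₁ b y (A₁.toLinearMap ∘ₗ y)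
    simp only [LinearMap.comp_apply, ContinuousLinearMap.coe_coe] at r₀ r₁
    rw [r₀, r₁, Finset.mul_sum, Finset.mul_sum, ← Finset.sum_add_distrib]
    refine Finset.sum_congr rfl fun i _ => ?_
    simp [hA, inner_smul_right_eq_smul]
  rw [e₁, e₂, e₃] at h
  nlinarith [mul_le_mul_of_nonneg_left h₀ hs, mul_le_mul_of_nonneg_left h₁ ht]

end HilbertSchmidt

/-! ### Variational formulas for parallel sums and resolvents. -/

section Kernels

variable {H : Type*} [NormedAddCommGroup H] [InnerProductSpace ℂ H]

lemma re_inner_apply_comm_of_nonneg {A : H →L[ℂ] H} (hA : 0 ≤ A) (x y : H) :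
    (⟪x, A y⟫_ℂ).re = (⟪y, A x⟫_ℂ).re := by
  have h := ((ContinuousLinearMap.nonneg_iff_isPositive A).1 hA).isSymmetric y x
  rw [ContinuousLinearMap.coe_coe] at h
  rw [← h, ← inner_conj_symm, Complex.conj_re]

lemma re_inner_apply_self_nonneg {A : H →L[ℂ] H} (hA : 0 ≤ A) (x : H) :
    0 ≤ (⟪x, A x⟫_ℂ).re :=
  ((ContinuousLinearMap.nonneg_iff_isPositive A).1 hA).re_inner_nonneg_right x

lemma re_inner_comm (x y : H) : (⟪x, y⟫_ℂ).re = (⟪y, x⟫_ℂ).re := by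
  rw [← inner_conj_symm, Complex.conj_re]

lemma re_inner_self_nonneg' (x : H) : 0 ≤ (⟪x, x⟫_ℂ).re := inner_self_nonneg (𝕜 := ℂ)

/-- Variational formula for the parallel sum of `A` and the scalar `m`: it is the minimum of
`⟨ξ - η, A (ξ - η)⟩ + m ‖η‖²`. -/
lemma parallel_sum_eq {A : H →L[ℂ] H} {m : ℝ} {ξ η : H} (h : A η + m • η = A ξ) :
    m * (⟪η, η⟫_ℂ).re + (⟪ξ - η, A (ξ - η)⟫_ℂ).re = m * (⟪ξ, η⟫_ℂ).re := by
  have h' : A (ξ - η) = m • η := by rw [map_sub, ← h]; abel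
  rw [h', inner_smul_right_eq_smul, Complex.smul_re, inner_sub_left, Complex.sub_re, smul_eq_mul]
  ring

/-- Completing the square: at `ζ = η + δ` the excess over the value at `η` is `⟨δ, (A + m) δ⟩ ≥ 0`.
-/
lemma parallel_sum_le {A : H →L[ℂ] H} (hA : 0 ≤ A) {m : ℝ} (hm : 0 ≤ m) {ξ η : H}
    (h : A η + m • η = A ξ) (ζ : H) :
    m * (⟪ξ, η⟫_ℂ).re ≤ m * (⟪ζ, ζ⟫_ℂ).re + (⟪ξ - ζ, A (ξ - ζ)⟫_ℂ).re := by
  have h' : A (ξ - η) = m • η := by rw [map_sub, ← h]; abel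
  rw [← parallel_sum_eq h]
  obtain ⟨δ, rfl⟩ : ∃ δ, ζ = η + δ := ⟨ζ - η, by abel⟩
  have e : ξ - (η + δ) = (ξ - η) - δ := by abel
  have e₁ : (⟪ξ - η, A δ⟫_ℂ).re = m * (⟪δ, η⟫_ℂ).re := by
    rw [re_inner_apply_comm_of_nonneg hA, h', inner_smul_right_eq_smul, Complex.smul_re,
      smul_eq_mul]
  have e₂ : (⟪δ, A (ξ - η)⟫_ℂ).re = m * (⟪δ, η⟫_ℂ).re := by
    rw [h', inner_smul_right_eq_smul, Complex.smul_re, smul_eq_mul]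
  have e₃ := re_inner_comm η δ
  have n₁ := re_inner_apply_self_nonneg hA δ
  have n₂ := mul_nonneg hm (re_inner_self_nonneg' δ)
  rw [e]
  generalize ξ - η = v at *
  rw [map_sub, inner_sub_left, inner_sub_right, inner_sub_right, inner_add_left, inner_add_right,
    inner_add_right]
  simp only [Complex.sub_re, Complex.add_re]
  rw [e₁, e₂, e₃]
  nlinarith

/-- Variational formula for the resolvent: `⟨v, (u + m A)⁻¹ v⟩` is the maximum of
`2 Re ⟨ζ, v⟩ - ⟨ζ, (u + m A) ζ⟩`. -/
lemma resolvent_eq {A : H →L[ℂ] H} {u m : ℝ} {v η : H} (h : u • η + m • A η = v) :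
    u * (⟪η, η⟫_ℂ).re + m * (⟪η, A η⟫_ℂ).re - 2 * (⟪η, v⟫_ℂ).re = -(⟪η, v⟫_ℂ).re := by
  have := congrArg (fun v => (⟪η, v⟫_ℂ).re) h
  simp only [inner_add_right, inner_smul_right_eq_smul, Complex.add_re, Complex.smul_re,
    smul_eq_mul] at this
  linarith

/-- Completing the square again: the excess at `η + δ` is `⟨δ, (u + m A) δ⟩ ≥ 0`. -/
lemma resolvent_le {A : H →L[ℂ] H} (hA : 0 ≤ A) {u m : ℝ} (hu : 0 ≤ u) (hm : 0 ≤ m) {v η : H}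
    (h : u • η + m • A η = v) (ζ : H) :
    -(⟪η, v⟫_ℂ).re ≤ u * (⟪ζ, ζ⟫_ℂ).re + m * (⟪ζ, A ζ⟫_ℂ).re - 2 * (⟪ζ, v⟫_ℂ).re := by
  rw [← resolvent_eq h]
  obtain ⟨δ, rfl⟩ : ∃ δ, ζ = η + δ := ⟨ζ - η, by abel⟩
  have h₁ := congrArg (fun v => (⟪δ, v⟫_ℂ).re) h
  simp only [inner_add_right, inner_smul_right_eq_smul, Complex.add_re, Complex.smul_re,
    smul_eq_mul] at h₁
  have e₁ := re_inner_apply_comm_of_nonneg hA η δ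
  have e₃ := re_inner_comm η δ
  have n₁ := mul_nonneg hm (re_inner_apply_self_nonneg hA δ)
  have n₂ := mul_nonneg hu (re_inner_self_nonneg' δ)
  simp only [map_add, inner_add_right, inner_add_left, Complex.add_re]
  rw [e₁, e₃]
  nlinarith

lemma apply_real_smul (A : H →L[ℂ] H) (c : ℝ) (x : H) : A (c • x) = c • A x :=
  A.map_smul_of_tower c x

lemma re_inner_real_smul (c : ℝ) (x y : H) : (⟪x, c • y⟫_ℂ).re = c * (⟪x, y⟫_ℂ).re := by
  rw [inner_smul_right_eq_smul, Complex.smul_re, smul_eq_mul]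

end Kernels

/-! ### Integral representation and scaling of operator powers. -/

section Powers

variable {R : Type*} [CStarAlgebra R] [PartialOrder R] [StarOrderedRing R]

open MeasureTheory Set

lemma exists_measure_rpow_eq_integral (R : Type*) [CStarAlgebra R] [PartialOrder R]
    [StarOrderedRing R] {p : ℝ} (h₀ : 0 < p) (h₁ : p < 1) :
    ∃ μ : Measure ℝ, ∀ a : R, 0 ≤ a →
      IntegrableOn (fun t => cfcₙ (Real.rpowIntegrand₀₁ p t) a) (Ioi 0) μ ∧
      a ^ p = ∫ t in Ioi 0, cfcₙ (Real.rpowIntegrand₀₁ p t) a ∂μ := by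
  lift p to NNReal using h₀.le
  obtain ⟨μ, hμ⟩ := CFC.exists_measure_nnrpow_eq_integral_cfcₙ_rpowIntegrand₀₁ R (p := p)
    ⟨by exact_mod_cast h₀, by exact_mod_cast h₁⟩
  refine ⟨μ, fun a ha => ⟨(hμ a ha).1, ?_⟩⟩
  rw [← (hμ a ha).2, CFC.nnrpow_eq_rpow (by exact_mod_cast h₀)]

/-- The integrand is `x ↦ t^(p-1) x / (t + x)`; this is the formula with the denominator cleared. -/
lemma add_smul_mul_cfc_rpowIntegrand {p t : ℝ} (h₀ : 0 < p) (h₁ : p < 1) (ht : 0 < t) {a : R}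
    (ha : 0 ≤ a) :
    a * cfcₙ (Real.rpowIntegrand₀₁ p t) a + t • cfcₙ (Real.rpowIntegrand₀₁ p t) a =
      t ^ (p - 1) • a := by
  have hsp : spectrum ℝ a ⊆ Ici 0 := fun x hx => spectrum_nonneg_of_nonneg ha hx
  have hc : ContinuousOn (Real.rpowIntegrand₀₁ p t) (spectrum ℝ a) :=
    (Real.continuousOn_rpowIntegrand₀₁_Ici ⟨h₀, h₁⟩ ht).mono hsp
  have hq : quasispectrum ℝ a ⊆ Ici 0 := fun x hx => quasispectrum_nonneg_of_nonneg a ha x hx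
  rw [cfcₙ_eq_cfc ((Real.continuousOn_rpowIntegrand₀₁_Ici ⟨h₀, h₁⟩ ht).mono hq)]
  have hid : a = cfc (fun x : ℝ => x) a := (cfc_id' ℝ a).symm
  conv_lhs => enter [1, 1]; rw [hid]
  conv_rhs => enter [2]; rw [hid]
  rw [← cfc_mul _ _ a, ← cfc_smul _ _ a, ← cfc_smul _ _ a, ← cfc_add a _ _]
  refine cfc_congr fun x hx => ?_
  have hx' : 0 ≤ x := hsp hx
  simp only [smul_eq_mul]
  rw [Real.rpowIntegrand₀₁_eq_pow_div ⟨h₀, h₁⟩ ht.le hx']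
  field_simp
  ring

/-- The alternative `0 < p ∨ IsUnit a` makes `x ↦ x^p` continuous on the spectrum; only `x = 0`
could obstruct. -/
lemma smul_rpow_of_nonneg {c p : ℝ} (hc : 0 < c) {a : R} (ha : 0 ≤ a)
    (h : 0 < p ∨ IsUnit a) : (c • a) ^ p = c ^ p • a ^ p := by
  have hsp : ∀ x ∈ spectrum ℝ a, 0 ≤ x := fun x hx => spectrum_nonneg_of_nonneg ha hx
  have hcont : ContinuousOn (fun x : ℝ => x ^ p) (spectrum ℝ a) := by
    refine ContinuousOn.rpow_const continuousOn_id fun x hx => ?_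
    rcases h with h | h
    · exact .inr h.le
    · exact .inl fun h0 => spectrum.zero_notMem ℝ h (h0 ▸ hx)
  rw [CFC.rpow_eq_cfc_real (smul_nonneg hc.le ha), CFC.rpow_eq_cfc_real ha, ← cfc_smul _ _ a hcont]
  have hcont' : ContinuousOn (fun x : ℝ => x ^ p) ((c • ·) '' spectrum ℝ a) := by
    refine ContinuousOn.rpow_const continuousOn_id ?_
    rintro _ ⟨x, hx, rfl⟩
    rcases h with h | h
    · exact .inr h.le
    · refine .inl ?_
      have : x ≠ 0 := fun h0 => spectrum.zero_notMem ℝ h (h0 ▸ hx)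
      simp [hc.ne', this]
  rw [← cfc_comp_smul c (fun x : ℝ => x ^ p) a hcont']
  refine cfc_congr fun x hx => ?_
  simp only [smul_eq_mul]
  rw [Real.mul_rpow hc.le (hsp x hx)]

end Powers

/-! ### Integrating pointwise joint concavity. -/

section JointConcavity

open MeasureTheory Set

variable {H : Type*} [NormedAddCommGroup H] [InnerProductSpace ℂ H] [CompleteSpace H]
variable {K : Type*} [NormedAddCommGroup K] [InnerProductSpace ℂ K] [FiniteDimensional ℂ K]

/-- The functional `v ↦ Re ⟨v, T v⟩` as a continuous real-linear map in `T`. -/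
noncomputable def reInnerCLM (v : H) : (H →L[ℂ] H) →L[ℝ] ℝ :=
  Complex.reCLM ∘L ((innerSL ℂ v).restrictScalars ℝ) ∘L
    ((ContinuousLinearMap.apply ℂ H v).restrictScalars ℝ)

omit [CompleteSpace H] in
@[simp] lemma reInnerCLM_apply (v : H) (T : H →L[ℂ] H) : reInnerCLM v T = (⟪v, T v⟫_ℂ).re := rfl

lemma exists_measure_re_inner_rpow {p : ℝ} (h₀ : 0 < p) (h₁ : p < 1) (H : Type*)
    [NormedAddCommGroup H] [InnerProductSpace ℂ H] [CompleteSpace H] :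
    ∃ μ : Measure ℝ, ∀ T : H →L[ℂ] H, 0 ≤ T → ∀ v : H,
      IntegrableOn (fun t => (⟪v, cfcₙ (Real.rpowIntegrand₀₁ p t) T v⟫_ℂ).re) (Ioi 0) μ ∧
      (⟪v, (T ^ p : H →L[ℂ] H) v⟫_ℂ).re =
        ∫ t in Ioi 0, (⟪v, cfcₙ (Real.rpowIntegrand₀₁ p t) T v⟫_ℂ).re ∂μ := by
  obtain ⟨μ, hμ⟩ := exists_measure_rpow_eq_integral (H →L[ℂ] H) h₀ h₁
  refine ⟨μ, fun T hT v => ⟨(reInnerCLM v).integrable_comp (hμ T hT).1, ?_⟩⟩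
  rw [(hμ T hT).2]
  exact ((reInnerCLM v).integral_comp_comm (hμ T hT).1).symm

lemma jointly_concave_of_integral {ι κ₀ κ₁ : Type*} [Fintype ι] [Fintype κ₀] [Fintype κ₁]
    {μ : Measure ℝ} {f : ι → ℝ → ℝ} {f₀ : κ₀ → ℝ → ℝ} {f₁ : κ₁ → ℝ → ℝ} {s t : ℝ}
    (hf : ∀ i, IntegrableOn (f i) (Ioi 0) μ) (hf₀ : ∀ i, IntegrableOn (f₀ i) (Ioi 0) μ)
    (hf₁ : ∀ i, IntegrableOn (f₁ i) (Ioi 0) μ)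
    (h : ∀ r, 0 < r → s * ∑ i, f₀ i r + t * ∑ i, f₁ i r ≤ ∑ i, f i r) :
    s * ∑ i, ∫ r in Ioi 0, f₀ i r ∂μ + t * ∑ i, ∫ r in Ioi 0, f₁ i r ∂μ ≤
      ∑ i, ∫ r in Ioi 0, f i r ∂μ := by
  rw [← integral_finsetSum _ fun i _ => hf i, ← integral_finsetSum _ fun i _ => hf₀ i,
    ← integral_finsetSum _ fun i _ => hf₁ i, ← integral_const_mul, ← integral_const_mul,
    ← integral_add]
  · refine setIntegral_mono_on ?_ ?_ measurableSet_Ioi fun r hr => h r hr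
    · exact ((integrable_finsetSum _ fun i _ => hf₀ i).const_mul s).add
        ((integrable_finsetSum _ fun i _ => hf₁ i).const_mul t)
    · exact integrable_finsetSum _ fun i _ => hf i
  · exact (integrable_finsetSum _ fun i _ => hf₀ i).const_mul s
  · exact (integrable_finsetSum _ fun i _ => hf₁ i).const_mul t

end JointConcavity

/-! ### The theorems of Lieb and Ando. -/

section LiebAndo

open MeasureTheory Set

variable {H : Type*} [NormedAddCommGroup H] [InnerProductSpace ℂ H] [CompleteSpace H]
variable {K : Type*} [NormedAddCommGroup K] [InnerProductSpace ℂ K] [FiniteDimensional ℂ K]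

/-- The operator on the left is `r^(p-1) u A / (A + r u)`, that is `r^(p-2)` times the parallel sum
of `A` and the scalar `r u`. For `u = 0` both sides vanish. -/
lemma exists_parallel_sum_resolvent {p r : ℝ} (h₀ : 0 < p) (h₁ : p < 1) (hr : 0 < r)
    {A : H →L[ℂ] H} (hA : 0 ≤ A) {u : ℝ} (hu : 0 ≤ u) (ξ : H) :
    ∃ η, A η + (r * u) • η = A ξ ∧
      u * (⟪ξ, cfcₙ (Real.rpowIntegrand₀₁ p r) (u⁻¹ • A) ξ⟫_ℂ).re =
        r ^ (p - 2) * ((r * u) * (⟪ξ, η⟫_ℂ).re) := by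
  rcases hu.eq_or_lt with rfl | hu
  · exact ⟨ξ, by simp, by simp⟩
  have hT : 0 ≤ u⁻¹ • A := smul_nonneg (inv_nonneg.2 hu.le) hA
  have key := congrArg (fun T : H →L[ℂ] H => u • T ξ) (add_smul_mul_cfc_rpowIntegrand h₀ h₁ hr hT)
  set R := cfcₙ (Real.rpowIntegrand₀₁ p r) (u⁻¹ • A) with hR
  simp only [add_apply, mul_apply_eq_comp,
    smul_apply] at key
  have hrp : r ^ (p - 1) ≠ 0 := (Real.rpow_pos_of_pos hr _).ne'
  refine ⟨(r ^ (p - 1))⁻¹ • R ξ, ?_, ?_⟩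
  · have h2 : A (R ξ) + (r * u) • R ξ = r ^ (p - 1) • A ξ := by
      rw [smul_add, smul_smul, smul_smul, smul_comm u (r ^ (p - 1)), smul_smul u,
        mul_inv_cancel₀ hu.ne', one_smul, one_smul, mul_comm u r] at key
      exact key
    rw [apply_real_smul, smul_comm, ← smul_add, h2, smul_smul, inv_mul_cancel₀ hrp, one_smul]
  · rw [inner_smul_right_eq_smul, Complex.smul_re, smul_eq_mul]
    have e : r ^ (p - 1) = r ^ (p - 2) * r := by
      rw [← Real.rpow_add_one hr.ne']; congr 1; ring
    have hrp2 : r ^ (p - 2) ≠ 0 := (Real.rpow_pos_of_pos hr _).ne'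
    rw [e]
    field_simp

/-- The operator on the left is `r^(q-1) u² / (u + r A)`, a resolvent of `A` itself, since
multiplying by `A` clears `A⁻¹`. -/
lemma exists_resolvent {q r : ℝ} (h₀ : 0 < q) (h₁ : q < 1) (hr : 0 < r)
    {A : H →L[ℂ] H} (hA : IsStrictlyPositive A) {u : ℝ} (hu : 0 ≤ u) (ξ : H) :
    ∃ η, u • η + r • A η = u • ξ ∧
      u * (⟪ξ, cfcₙ (Real.rpowIntegrand₀₁ q r) (u • (A ^ (-1 : ℝ) : H →L[ℂ] H)) ξ⟫_ℂ).re =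
        r ^ (q - 1) * (u * (⟪η, ξ⟫_ℂ).re) := by
  have hT : 0 ≤ u • (A ^ (-1 : ℝ) : H →L[ℂ] H) := smul_nonneg hu CFC.rpow_nonneg
  have key := congrArg (fun T : H →L[ℂ] H => A (T ξ)) (add_smul_mul_cfc_rpowIntegrand h₀ h₁ hr hT)
  set R := cfcₙ (Real.rpowIntegrand₀₁ q r) (u • (A ^ (-1 : ℝ) : H →L[ℂ] H)) with hR
  have hinv : ∀ x, A ((A ^ (-1 : ℝ) : H →L[ℂ] H) x) = x := fun x => by
    have := CFC.rpow_mul_rpow_neg (1 : ℝ) hA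
    rw [CFC.rpow_one A hA.nonneg] at this
    exact congrArg (fun T : H →L[ℂ] H => T x) this
  simp only [add_apply, mul_apply_eq_comp,
    smul_apply, map_add, apply_real_smul, hinv] at key
  have hrp : r ^ (q - 1) ≠ 0 := (Real.rpow_pos_of_pos hr _).ne'
  refine ⟨(r ^ (q - 1))⁻¹ • R ξ, ?_, ?_⟩
  · rw [apply_real_smul, smul_comm, smul_comm r, ← smul_add, key, smul_smul,
      inv_mul_cancel₀ hrp, one_smul]
  · rw [re_inner_comm _ ξ, inner_smul_right_eq_smul, Complex.smul_re, smul_eq_mul]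
    field_simp

section

variable {ι κ₀ κ₁ : Type*} [Fintype ι] [Fintype κ₀] [Fintype κ₁]
    (b : OrthonormalBasis ι ℂ K) (b₀ : OrthonormalBasis κ₀ ℂ K) (b₁ : OrthonormalBasis κ₁ ℂ K)
    {Z Z₀ Z₁ : K →ₗ[ℂ] K} {u : ι → ℝ} {u₀ : κ₀ → ℝ} {u₁ : κ₁ → ℝ} {s t : ℝ}
    (hu : ∀ i, Z (b i) = (u i : ℂ) • b i) (hu₀ : ∀ i, Z₀ (b₀ i) = (u₀ i : ℂ) • b₀ i)
    (hu₁ : ∀ i, Z₁ (b₁ i) = (u₁ i : ℂ) • b₁ i) (hZ : Z = (s : ℂ) • Z₀ + (t : ℂ) • Z₁)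
    (hs : 0 ≤ s) (ht : 0 ≤ t) (hu' : ∀ i, 0 ≤ u i) (hu₀' : ∀ i, 0 ≤ u₀ i) (hu₁' : ∀ i, 0 ≤ u₁ i)
    (B : K →ₗ[ℂ] H) {A A₀ A₁ : H →L[ℂ] H} (hA : A = s • A₀ + t • A₁)

include hu hu₀ hu₁ hZ hs ht hu' hu₀' hu₁' hA

/-- **Lieb's concavity theorem** for the exponents `p` and `1 - p`. -/
lemma lieb_concavity {p : ℝ} (h₀ : 0 < p) (h₁ : p < 1) (pA : 0 ≤ A) (pA₀ : 0 ≤ A₀) (pA₁ : 0 ≤ A₁) :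
    s * ∑ i, u₀ i ^ (1 - p) * (⟪B (b₀ i), (A₀ ^ p : H →L[ℂ] H) (B (b₀ i))⟫_ℂ).re +
      t * ∑ i, u₁ i ^ (1 - p) * (⟪B (b₁ i), (A₁ ^ p : H →L[ℂ] H) (B (b₁ i))⟫_ℂ).re ≤
    ∑ i, u i ^ (1 - p) * (⟪B (b i), (A ^ p : H →L[ℂ] H) (B (b i))⟫_ℂ).re := by
  obtain ⟨μ, hμ⟩ := exists_measure_re_inner_rpow h₀ h₁ H
  have hpos : ∀ {C : H →L[ℂ] H} {w : ℝ}, 0 ≤ C → 0 ≤ w → 0 ≤ w⁻¹ • C :=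
    fun hC hw => smul_nonneg (inv_nonneg.2 hw) hC
  -- `w^(1-p) C^p = w (w⁻¹ C)^p` moves the scalar inside the power, making the integrand homogeneous
  -- of degree one in `(C, w)`.
  have key : ∀ {C : H →L[ℂ] H} {w : ℝ} (v : H), 0 ≤ C → 0 ≤ w →
      w ^ (1 - p) * (⟪v, (C ^ p : H →L[ℂ] H) v⟫_ℂ).re =
      ∫ r in Ioi 0, w * (⟪v, cfcₙ (Real.rpowIntegrand₀₁ p r) (w⁻¹ • C) v⟫_ℂ).re ∂μ := by
    intro C w v hC hw
    rw [integral_const_mul, ← (hμ _ (hpos hC hw) v).2]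
    rcases hw.eq_or_lt with rfl | hw
    · rw [Real.zero_rpow (by linarith)]; simp
    rw [smul_rpow_of_nonneg (inv_pos.2 hw) hC (.inl h₀), smul_apply,
      inner_smul_right_eq_smul, Complex.smul_re, smul_eq_mul, ← mul_assoc, Real.inv_rpow hw.le,
      Real.rpow_sub hw, Real.rpow_one, div_eq_mul_inv]
  simp only [key _ pA (hu' _), key _ pA₀ (hu₀' _), key _ pA₁ (hu₁' _)]
  refine jointly_concave_of_integral (fun i => (hμ _ (hpos pA (hu' i)) _).1.const_mul _)
    (fun i => (hμ _ (hpos pA₀ (hu₀' i)) _).1.const_mul _)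
    (fun i => (hμ _ (hpos pA₁ (hu₁' i)) _).1.const_mul _) fun r hr => ?_
  have hr2 : 0 ≤ r ^ (p - 2) := (Real.rpow_pos_of_pos hr _).le
  have upper : ∀ {C : H →L[ℂ] H} {w : ℝ}, 0 ≤ C → 0 ≤ w → ∀ ξ η : H,
      w * (⟪ξ, cfcₙ (Real.rpowIntegrand₀₁ p r) (w⁻¹ • C) ξ⟫_ℂ).re ≤
      (r ^ (p - 2) * r) * (w * (⟪η, η⟫_ℂ).re)
      + r ^ (p - 2) * (⟪(1 : ℂ) • ξ - η, C ((1 : ℂ) • ξ - η)⟫_ℂ).re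
      - 0 * (w * (⟪η, ξ⟫_ℂ).re) := by
    intro C w hC hw ξ η
    obtain ⟨ζ, hζ, e⟩ := exists_parallel_sum_resolvent h₀ h₁ hr hC hw ξ
    rw [e, one_smul]
    have := mul_le_mul_of_nonneg_left (parallel_sum_le hC (mul_nonneg hr.le hw) hζ η) hr2
    linarith
  refine jointly_concave_of_variational b b₀ b₁ hu hu₀ hu₁ hZ hs ht B hA
    (fun C w ξ => w * (⟪ξ, cfcₙ (Real.rpowIntegrand₀₁ p r) (w⁻¹ • C) ξ⟫_ℂ).re)
    (r ^ (p - 2) * r) (r ^ (p - 2)) 0 1 ?_ (fun i => upper pA₀ (hu₀' i))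
    (fun i => upper pA₁ (hu₁' i))
  intro i
  obtain ⟨ζ, hζ, e⟩ := exists_parallel_sum_resolvent h₀ h₁ hr pA (hu' i) (B (b i))
  refine ⟨ζ, ?_⟩
  rw [e, one_smul, ← parallel_sum_eq hζ]
  linarith

/-- **Ando's convexity theorem** for the exponents `-q` and `1 + q`, `0 < q < 1`. -/
lemma ando_convexity_of_lt_one {q : ℝ} (h₀ : 0 < q) (h₁ : q < 1) (pA : IsStrictlyPositive A)
    (pA₀ : IsStrictlyPositive A₀) (pA₁ : IsStrictlyPositive A₁) :
    ∑ i, u i ^ (1 + q) * (⟪B (b i), (A ^ (-q) : H →L[ℂ] H) (B (b i))⟫_ℂ).re ≤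
    s * ∑ i, u₀ i ^ (1 + q) * (⟪B (b₀ i), (A₀ ^ (-q) : H →L[ℂ] H) (B (b₀ i))⟫_ℂ).re +
      t * ∑ i, u₁ i ^ (1 + q) * (⟪B (b₁ i), (A₁ ^ (-q) : H →L[ℂ] H) (B (b₁ i))⟫_ℂ).re := by
  obtain ⟨μ, hμ⟩ := exists_measure_re_inner_rpow h₀ h₁ H
  have hpos : ∀ {C : H →L[ℂ] H} {w : ℝ}, 0 ≤ w → 0 ≤ w • (C ^ (-1 : ℝ) : H →L[ℂ] H) :=
    fun hw => smul_nonneg hw CFC.rpow_nonneg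
  -- `w^(1+q) C^(-q) = w (w C⁻¹)^q`; the minus signs turn the claim into concavity.
  have key : ∀ {C : H →L[ℂ] H} {w : ℝ} (v : H), IsStrictlyPositive C → 0 ≤ w →
      w ^ (1 + q) * (⟪v, (C ^ (-q) : H →L[ℂ] H) v⟫_ℂ).re =
      -∫ r in Ioi 0, (-w) * (⟪v, cfcₙ (Real.rpowIntegrand₀₁ q r)
        (w • (C ^ (-1 : ℝ) : H →L[ℂ] H)) v⟫_ℂ).re ∂μ := by
    intro C w v hC hw
    rw [integral_const_mul, ← (hμ _ (hpos hw) v).2]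
    rcases hw.eq_or_lt with rfl | hw
    · rw [Real.zero_rpow (by linarith)]; simp
    rw [smul_rpow_of_nonneg hw CFC.rpow_nonneg (.inl h₀), smul_apply,
      inner_smul_right_eq_smul, Complex.smul_re, smul_eq_mul, neg_mul, neg_neg, ← mul_assoc,
      Real.rpow_add hw, Real.rpow_one, CFC.rpow_rpow C (-1) q (by norm_num) hC, neg_one_mul]
  simp only [key _ pA (hu' _), key _ pA₀ (hu₀' _), key _ pA₁ (hu₁' _), Finset.sum_neg_distrib]
  have main := jointly_concave_of_integral (s := s) (t := t) (μ := μ)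
    (f := fun i r => -(u i) * (⟪B (b i), cfcₙ (Real.rpowIntegrand₀₁ q r)
        (u i • (A ^ (-1 : ℝ) : H →L[ℂ] H)) (B (b i))⟫_ℂ).re)
    (f₀ := fun i r => -(u₀ i) * (⟪B (b₀ i), cfcₙ (Real.rpowIntegrand₀₁ q r)
        (u₀ i • (A₀ ^ (-1 : ℝ) : H →L[ℂ] H)) (B (b₀ i))⟫_ℂ).re)
    (f₁ := fun i r => -(u₁ i) * (⟪B (b₁ i), cfcₙ (Real.rpowIntegrand₀₁ q r)
        (u₁ i • (A₁ ^ (-1 : ℝ) : H →L[ℂ] H)) (B (b₁ i))⟫_ℂ).re)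
    (fun i => (hμ _ (hpos (hu' i)) _).1.const_mul _)
    (fun i => (hμ _ (hpos (hu₀' i)) _).1.const_mul _)
    (fun i => (hμ _ (hpos (hu₁' i)) _).1.const_mul _) fun r hr => ?_
  · linarith
  have hr2 : 0 ≤ r ^ (q - 1) := (Real.rpow_pos_of_pos hr _).le
  -- Taking `a = 0` in the variational scheme leaves `⟨η, C η⟩`, as the resolvent formula requires.
  have upper : ∀ {C : H →L[ℂ] H} {w : ℝ}, IsStrictlyPositive C → 0 ≤ w → ∀ ξ η : H,
      -w * (⟪ξ, cfcₙ (Real.rpowIntegrand₀₁ q r) (w • (C ^ (-1 : ℝ) : H →L[ℂ] H)) ξ⟫_ℂ).re ≤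
      r ^ (q - 1) * (w * (⟪η, η⟫_ℂ).re)
      + (r ^ (q - 1) * r) * (⟪(0 : ℂ) • ξ - η, C ((0 : ℂ) • ξ - η)⟫_ℂ).re
      - (2 * r ^ (q - 1)) * (w * (⟪η, ξ⟫_ℂ).re) := by
    intro C w hC hw ξ η
    obtain ⟨ζ, hζ, e⟩ := exists_resolvent h₀ h₁ hr hC hw ξ
    rw [neg_mul, e, zero_smul, zero_sub, map_neg, inner_neg_neg]
    have := mul_le_mul_of_nonneg_left (resolvent_le hC.nonneg hw hr.le hζ η) hr2
    rw [re_inner_real_smul, re_inner_real_smul] at this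
    linarith
  refine jointly_concave_of_variational b b₀ b₁ hu hu₀ hu₁ hZ hs ht B hA
    (fun C w ξ => -w * (⟪ξ, cfcₙ (Real.rpowIntegrand₀₁ q r)
      (w • (C ^ (-1 : ℝ) : H →L[ℂ] H)) ξ⟫_ℂ).re)
    (r ^ (q - 1)) (r ^ (q - 1) * r) (2 * r ^ (q - 1)) 0 ?_ (fun i => upper pA₀ (hu₀' i))
    (fun i => upper pA₁ (hu₁' i))
  intro i
  obtain ⟨ζ, hζ, e⟩ := exists_resolvent h₀ h₁ hr pA (hu' i) (B (b i))
  refine ⟨ζ, ?_⟩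
  have := congrArg (r ^ (q - 1) * ·) (resolvent_eq hζ)
  simp only [re_inner_real_smul] at this
  rw [neg_mul, e, zero_smul, zero_sub, map_neg, inner_neg_neg]
  linarith

omit hu' hu₀' hu₁' in
/-- Joint convexity of `(A, Z) ↦ tr Z B* A⁻¹ B Z`. -/
lemma ando_convexity_one (pA : IsStrictlyPositive A)
    (pA₀ : IsStrictlyPositive A₀) (pA₁ : IsStrictlyPositive A₁) :
    ∑ i, u i ^ (2 : ℝ) * (⟪B (b i), (A ^ (-1 : ℝ) : H →L[ℂ] H) (B (b i))⟫_ℂ).re ≤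
    s * ∑ i, u₀ i ^ (2 : ℝ) * (⟪B (b₀ i), (A₀ ^ (-1 : ℝ) : H →L[ℂ] H) (B (b₀ i))⟫_ℂ).re +
      t * ∑ i, u₁ i ^ (2 : ℝ) * (⟪B (b₁ i), (A₁ ^ (-1 : ℝ) : H →L[ℂ] H) (B (b₁ i))⟫_ℂ).re := by
  have hinv : ∀ {C : H →L[ℂ] H}, IsStrictlyPositive C → ∀ x,
      C ((C ^ (-1 : ℝ) : H →L[ℂ] H) x) = x := fun {C} hC x => by
    have := CFC.rpow_mul_rpow_neg (1 : ℝ) hC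
    rw [CFC.rpow_one C hC.nonneg] at this
    exact congrArg (fun T : H →L[ℂ] H => T x) this
  -- No integral is needed: `-w² ⟨ξ, C⁻¹ ξ⟩` is the minimum of `⟨η, C η⟩ - 2 w Re ⟨η, ξ⟩`.
  have main := jointly_concave_of_variational b b₀ b₁ hu hu₀ hu₁ hZ hs ht B hA
    (fun C w ξ => -(w ^ (2 : ℝ) * (⟪ξ, (C ^ (-1 : ℝ) : H →L[ℂ] H) ξ⟫_ℂ).re)) 0 1 2 0
  have sol : ∀ {C : H →L[ℂ] H}, IsStrictlyPositive C → ∀ (w : ℝ) (ξ : H),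
      (0 : ℝ) • (w • (C ^ (-1 : ℝ) : H →L[ℂ] H) ξ) + (1 : ℝ) • C (w • (C ^ (-1 : ℝ) : H →L[ℂ] H) ξ)
        = w • ξ := by
    intro C hC w ξ
    rw [apply_real_smul, hinv hC, zero_smul, zero_add, one_smul]
  have val : ∀ (C : H →L[ℂ] H) (w : ℝ) (ξ : H),
      w ^ (2 : ℝ) * (⟪ξ, (C ^ (-1 : ℝ) : H →L[ℂ] H) ξ⟫_ℂ).re =
        (⟪w • (C ^ (-1 : ℝ) : H →L[ℂ] H) ξ, w • ξ⟫_ℂ).re := by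
    intro C w ξ
    rw [re_inner_real_smul, re_inner_comm (w • _), re_inner_real_smul, Real.rpow_two]
    ring
  have upper : ∀ {C : H →L[ℂ] H} {w : ℝ}, IsStrictlyPositive C → ∀ ξ η : H,
      -(w ^ (2 : ℝ) * (⟪ξ, (C ^ (-1 : ℝ) : H →L[ℂ] H) ξ⟫_ℂ).re) ≤
      0 * (w * (⟪η, η⟫_ℂ).re)
      + 1 * (⟪(0 : ℂ) • ξ - η, C ((0 : ℂ) • ξ - η)⟫_ℂ).re
      - 2 * (w * (⟪η, ξ⟫_ℂ).re) := by
    intro C w hC ξ η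
    have := resolvent_le hC.nonneg le_rfl zero_le_one (sol hC w ξ) η
    rw [val, zero_smul, zero_sub, map_neg, inner_neg_neg]
    rw [re_inner_real_smul w η] at this
    linarith
  have lower : ∀ {C : H →L[ℂ] H} {w : ℝ}, IsStrictlyPositive C → ∀ ξ : H, ∃ η,
      0 * (w * (⟪η, η⟫_ℂ).re)
      + 1 * (⟪(0 : ℂ) • ξ - η, C ((0 : ℂ) • ξ - η)⟫_ℂ).re
      - 2 * (w * (⟪η, ξ⟫_ℂ).re) ≤
      -(w ^ (2 : ℝ) * (⟪ξ, (C ^ (-1 : ℝ) : H →L[ℂ] H) ξ⟫_ℂ).re) := by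
    intro C w hC ξ
    refine ⟨w • (C ^ (-1 : ℝ) : H →L[ℂ] H) ξ, ?_⟩
    have := resolvent_eq (sol hC w ξ)
    rw [val, ← this, zero_smul, zero_sub, map_neg, inner_neg_neg, re_inner_real_smul w _ ξ]
    linarith
  have := main (fun i => lower pA _) (fun i => upper pA₀) (fun i => upper pA₁)
  simp only [Finset.sum_neg_distrib] at this
  linarith

end

end LiebAndo

/-! ### The scalar Young inequality. -/

section Young

/-- The functional whose maximum over `u ≥ 0` is `x ^ (1 / p)`. -/
noncomputable def youngFun (p x u : ℝ) : ℝ := (1 / p) * (u ^ (1 - p) * x) + (1 - 1 / p) * u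

/-- Weighted AM-GM for `x^(1/p)` and `u` with weights `p` and `1 - p`. -/
lemma youngFun_le_of_pos {p x u : ℝ} (h₀ : 0 < p) (h₁ : p ≤ 1) (hx : 0 ≤ x) (hu : 0 ≤ u) :
    youngFun p x u ≤ x ^ (1 / p) := by
  have h := Real.geom_mean_le_arith_mean2_weighted h₀.le (sub_nonneg.2 h₁)
    (Real.rpow_nonneg hx (1 / p)) hu (by ring)
  rw [← Real.rpow_mul hx, one_div_mul_cancel h₀.ne', Real.rpow_one] at h
  unfold youngFun
  have := mul_le_mul_of_nonneg_left h (one_div_pos.2 h₀).le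
  have e : 1 / p * (p * x ^ (1 / p) + (1 - p) * u) = x ^ (1 / p) + (1 / p - 1) * u := by
    field_simp
  rw [e] at this
  linarith

/-- With `y = x^(1/p)`, AM-GM is applied to `y` and `u^(1-p) y^p` with weights `-p/(1-p)` and
`1/(1-p)`, whose geometric mean is `u`. It fails at `x = 0`, `u > 0`, because real `0^(1/p)` is `0`.
-/
lemma youngFun_le_of_neg {p x u : ℝ} (hp : p < 0) (hx : 0 < x) (hu : 0 ≤ u) :
    youngFun p x u ≤ x ^ (1 / p) := by
  set y := x ^ (1 / p) with hy
  have hy0 : 0 < y := Real.rpow_pos_of_pos hx _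
  have hxy : x = y ^ p := by
    rw [hy, ← Real.rpow_mul hx.le, one_div_mul_cancel hp.ne, Real.rpow_one]
  have h1p : 0 < 1 - p := by linarith
  have h := Real.geom_mean_le_arith_mean2_weighted (w₁ := (-p) / (1 - p)) (w₂ := 1 / (1 - p))
    (div_nonneg (by linarith) h1p.le) (one_div_pos.2 h1p).le hy0.le
    (mul_nonneg (Real.rpow_nonneg hu (1 - p)) (Real.rpow_nonneg hy0.le p)) (by field_simp; ring)
  have e : y ^ (-p / (1 - p)) * (u ^ (1 - p) * y ^ p) ^ (1 / (1 - p)) = u := by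
    rw [Real.mul_rpow (Real.rpow_nonneg hu _) (Real.rpow_nonneg hy0.le _), ← Real.rpow_mul hu,
      ← Real.rpow_mul hy0.le, mul_one_div_cancel h1p.ne', Real.rpow_one, mul_left_comm,
      ← Real.rpow_add hy0]
    have : -p / (1 - p) + p * (1 / (1 - p)) = 0 := by field_simp; ring
    rw [this, Real.rpow_zero, mul_one]
  rw [e, ← hxy] at h
  unfold youngFun
  have h2 := mul_le_mul_of_nonneg_left h (div_pos h1p (neg_pos.2 hp)).le
  have hp0 : p ≠ 0 := hp.ne
  have e2 : (1 - p) / -p * (-p / (1 - p) * y + 1 / (1 - p) * (u ^ (1 - p) * x)) =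
      y - 1 / p * (u ^ (1 - p) * x) := by
    field_simp
    ring
  have e3 : (1 - p) / -p * u = (1 - 1 / p) * u := by
    field_simp
    ring
  rw [e2, e3] at h2
  linarith

lemma youngFun_zero_right {p x : ℝ} (hp : p < 1) : youngFun p x 0 = 0 := by
  simp [youngFun, Real.zero_rpow (sub_pos.2 hp).ne']

lemma youngFun_rpow {p x : ℝ} (hp : p ≠ 0) (hx : 0 ≤ x) :
    youngFun p x (x ^ (1 / p)) = x ^ (1 / p) := by
  unfold youngFun
  rcases hx.eq_or_lt with rfl | hx
  · simp [Real.zero_rpow (inv_ne_zero hp)]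
  · have : (x ^ (1 / p)) ^ (1 - p) * x = x ^ (1 / p) := by
      rw [← Real.rpow_mul hx.le]
      nth_rewrite 2 [← Real.rpow_one x]
      rw [← Real.rpow_add hx]
      congr 1
      field_simp
      ring
    rw [this]
    ring

lemma youngFun_antitone_of_neg {p u x y : ℝ} (hp : p < 0) (hu : 0 ≤ u) (h : x ≤ y) :
    youngFun p y u ≤ youngFun p x u := by
  unfold youngFun
  have := mul_le_mul_of_nonneg_left h (Real.rpow_nonneg hu (1 - p))
  have := mul_le_mul_of_nonpos_left this (one_div_neg.2 hp).le
  linarith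

lemma youngFun_sum {κ : Type*} [Fintype κ] {p u : ℝ} {c x : κ → ℝ} (hc : ∑ k, c k = 1) :
    youngFun p (∑ k, c k * x k) u = ∑ k, c k * youngFun p (x k) u := by
  unfold youngFun
  simp only [mul_add, Finset.sum_add_distrib]
  rw [← Finset.sum_mul, hc, one_mul, Finset.mul_sum, Finset.mul_sum]
  congr 1
  exact Finset.sum_congr rfl fun k _ => by ring

end Young

/-! ### Peierls inequality and joint concavity of the Young functional. -/

section Core

variable {H : Type*} [NormedAddCommGroup H] [InnerProductSpace ℂ H] [CompleteSpace H]
variable {K : Type*} [NormedAddCommGroup K] [InnerProductSpace ℂ K] [FiniteDimensional ℂ K]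

omit [FiniteDimensional ℂ K] in
/-- The Peierls inequality, in terms of the diagonal entries in one basis and the eigenvalues in
another one. -/
lemma sum_youngFun_le_sum_rpow {ι κ : Type*} [Fintype ι] [Fintype κ]
    (g : OrthonormalBasis ι ℂ K) (h : OrthonormalBasis κ ℂ K) {p : ℝ} {x : κ → ℝ} {u y : ι → ℝ}
    (hy : ∀ j, y j = ∑ k, ‖⟪h k, g j⟫_ℂ‖ ^ 2 * x k)
    (hYoung : ∀ j k, youngFun p (x k) (u j) ≤ x k ^ (1 / p) ∨ ⟪h k, g j⟫_ℂ = 0) :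
    ∑ j, youngFun p (y j) (u j) ≤ ∑ k, x k ^ (1 / p) := by
  have h1 : ∀ j, youngFun p (y j) (u j) ≤ ∑ k, ‖⟪h k, g j⟫_ℂ‖ ^ 2 * x k ^ (1 / p) := by
    intro j
    rw [hy j, youngFun_sum]
    · refine Finset.sum_le_sum fun k _ => ?_
      rcases hYoung j k with h2 | h2
      · exact mul_le_mul_of_nonneg_left h2 (sq_nonneg _)
      · simp [h2]
    · rw [h.sum_sq_norm_inner_right]
      simp
  -- The squared overlaps of two orthonormal bases are doubly stochastic: sums over `k` gave `h1`,
  -- sums over `j` finish.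
  refine (Finset.sum_le_sum fun j _ => h1 j).trans_eq ?_
  rw [Finset.sum_comm]
  refine Finset.sum_congr rfl fun k _ => ?_
  rw [← Finset.sum_mul, g.sum_sq_norm_inner_left]
  simp

/-- Joint concavity of `(A, Z) ↦ (1 / p) tr B* A ^ p B Z ^ (1 - p) + (1 - 1 / p) tr Z`. -/
lemma sum_youngFun_concave {ι κ₀ κ₁ : Type*} [Fintype ι] [Fintype κ₀] [Fintype κ₁]
    (b : OrthonormalBasis ι ℂ K) (b₀ : OrthonormalBasis κ₀ ℂ K) (b₁ : OrthonormalBasis κ₁ ℂ K)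
    {Z Z₀ Z₁ : K →ₗ[ℂ] K} {u : ι → ℝ} {u₀ : κ₀ → ℝ} {u₁ : κ₁ → ℝ} {s t : ℝ}
    (hu : ∀ i, Z (b i) = (u i : ℂ) • b i) (hu₀ : ∀ i, Z₀ (b₀ i) = (u₀ i : ℂ) • b₀ i)
    (hu₁ : ∀ i, Z₁ (b₁ i) = (u₁ i : ℂ) • b₁ i) (hZ : Z = (s : ℂ) • Z₀ + (t : ℂ) • Z₁)
    (hs : 0 ≤ s) (ht : 0 ≤ t) (hu' : ∀ i, 0 ≤ u i) (hu₀' : ∀ i, 0 ≤ u₀ i) (hu₁' : ∀ i, 0 ≤ u₁ i)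
    (B : K →ₗ[ℂ] H) {A A₀ A₁ : H →L[ℂ] H} (hA : A = s • A₀ + t • A₁)
    {p : ℝ} (hp_lower : -1 ≤ p) (hp_upper : p ≤ 1) (hp_ne : p ≠ 0)
    (pA : 0 ≤ A) (pA₀ : 0 ≤ A₀) (pA₁ : 0 ≤ A₁)
    (sA : p < 0 → IsUnit A) (sA₀ : p < 0 → IsUnit A₀) (sA₁ : p < 0 → IsUnit A₁) :
    s * ∑ i, youngFun p (⟪B (b₀ i), (A₀ ^ p : H →L[ℂ] H) (B (b₀ i))⟫_ℂ).re (u₀ i) +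
      t * ∑ i, youngFun p (⟪B (b₁ i), (A₁ ^ p : H →L[ℂ] H) (B (b₁ i))⟫_ℂ).re (u₁ i) ≤
    ∑ i, youngFun p (⟪B (b i), (A ^ p : H →L[ℂ] H) (B (b i))⟫_ℂ).re (u i) := by
  have : CompleteSpace K := FiniteDimensional.complete ℂ K
  have htr := sum_re_inner_eigenbasis_add b b₀ b₁ hu hu₀ hu₁ hZ LinearMap.id LinearMap.id
  simp only [LinearMap.id_apply, OrthonormalBasis.inner_eq_one, Complex.one_re, mul_one] at htr
  have main : s * ((1 / p) * ∑ i, u₀ i ^ (1 - p) * (⟪B (b₀ i), (A₀ ^ p : H →L[ℂ] H) (B (b₀ i))⟫_ℂ).re) +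
      t * ((1 / p) * ∑ i, u₁ i ^ (1 - p) * (⟪B (b₁ i), (A₁ ^ p : H →L[ℂ] H) (B (b₁ i))⟫_ℂ).re) ≤
      (1 / p) * ∑ i, u i ^ (1 - p) * (⟪B (b i), (A ^ p : H →L[ℂ] H) (B (b i))⟫_ℂ).re := by
    rcases lt_or_gt_of_ne hp_ne with hneg | hpos
    · have h : ∑ i, u i ^ (1 - p) * (⟪B (b i), (A ^ p : H →L[ℂ] H) (B (b i))⟫_ℂ).re ≤
          s * ∑ i, u₀ i ^ (1 - p) * (⟪B (b₀ i), (A₀ ^ p : H →L[ℂ] H) (B (b₀ i))⟫_ℂ).re +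
          t * ∑ i, u₁ i ^ (1 - p) * (⟪B (b₁ i), (A₁ ^ p : H →L[ℂ] H) (B (b₁ i))⟫_ℂ).re := by
        rcases hp_lower.eq_or_lt with rfl | hlt
        · have := ando_convexity_one b b₀ b₁ hu hu₀ hu₁ hZ hs ht B hA
            ⟨pA, sA hneg⟩ ⟨pA₀, sA₀ hneg⟩ ⟨pA₁, sA₁ hneg⟩
          norm_num at this ⊢
          exact this
        · have := ando_convexity_of_lt_one b b₀ b₁ hu hu₀ hu₁ hZ hs ht hu' hu₀' hu₁' B hA
            (neg_pos.2 hneg) (by linarith) ⟨pA, sA hneg⟩ ⟨pA₀, sA₀ hneg⟩ ⟨pA₁, sA₁ hneg⟩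
          simpa only [neg_neg, ← sub_eq_add_neg] using this
      have := mul_le_mul_of_nonpos_left h (one_div_neg.2 hneg).le
      linarith
    · have h : s * ∑ i, u₀ i ^ (1 - p) * (⟪B (b₀ i), (A₀ ^ p : H →L[ℂ] H) (B (b₀ i))⟫_ℂ).re +
          t * ∑ i, u₁ i ^ (1 - p) * (⟪B (b₁ i), (A₁ ^ p : H →L[ℂ] H) (B (b₁ i))⟫_ℂ).re ≤
          ∑ i, u i ^ (1 - p) * (⟪B (b i), (A ^ p : H →L[ℂ] H) (B (b i))⟫_ℂ).re := by
        rcases hp_upper.eq_or_lt with rfl | hlt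
        -- For `p = 1` the weight `u^(1-p)` is `1`, so the sum is a trace linear in `A` and equality
        -- holds.
        · have r₀ := sum_re_inner_orthonormalBasis_eq b₀ b B (A₀.toLinearMap ∘ₗ B)
          have r₁ := sum_re_inner_orthonormalBasis_eq b₁ b B (A₁.toLinearMap ∘ₗ B)
          simp only [LinearMap.comp_apply, ContinuousLinearMap.coe_coe] at r₀ r₁
          simp only [CFC.rpow_one A pA, CFC.rpow_one A₀ pA₀, CFC.rpow_one A₁ pA₁, sub_self,
            Real.rpow_zero, one_mul]
          rw [r₀, r₁, Finset.mul_sum, Finset.mul_sum, ← Finset.sum_add_distrib]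
          refine (Finset.sum_congr rfl fun i _ => ?_).le
          simp [hA, inner_smul_right_eq_smul]
        · exact lieb_concavity b b₀ b₁ hu hu₀ hu₁ hZ hs ht hu' hu₀' hu₁' B hA hpos hlt pA pA₀ pA₁
      have := mul_le_mul_of_nonneg_left h (one_div_pos.2 hpos).le
      linarith
  simp only [youngFun, Finset.sum_add_distrib, ← Finset.mul_sum]
  rw [htr]
  linarith

end Core

/-! ### Diagonalization on finite-dimensional spaces. -/

section Eigenbases

variable {H : Type*} [NormedAddCommGroup H] [InnerProductSpace ℂ H] [CompleteSpace H]
variable {K : Type*} [NormedAddCommGroup K] [InnerProductSpace ℂ K]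

lemma apply_eq_sum_of_eigenbasis {κ : Type*} [Fintype κ] (h : OrthonormalBasis κ ℂ K)
    {X : K →ₗ[ℂ] K} {x : κ → ℝ} (hX : ∀ k, X (h k) = (x k : ℂ) • h k) (v : K) :
    X v = ∑ k, ((x k : ℂ) * ⟪h k, v⟫_ℂ) • h k := by
  conv_lhs => rw [← h.sum_repr' v]
  rw [map_sum]
  refine Finset.sum_congr rfl fun k _ => ?_
  rw [map_smul, hX, smul_smul, mul_comm]

lemma re_inner_apply_eq_sum_of_eigenbasis {κ : Type*} [Fintype κ] (h : OrthonormalBasis κ ℂ K)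
    {X : K →ₗ[ℂ] K} {x : κ → ℝ} (hX : ∀ k, X (h k) = (x k : ℂ) • h k) (v : K) :
    (⟪v, X v⟫_ℂ).re = ∑ k, ‖⟪h k, v⟫_ℂ‖ ^ 2 * x k := by
  rw [apply_eq_sum_of_eigenbasis h hX, inner_sum, Complex.re_sum]
  refine Finset.sum_congr rfl fun k _ => ?_
  rw [inner_smul_right, mul_assoc, ← inner_conj_symm v, ← Complex.normSq_eq_norm_sq,
    Complex.mul_conj, ← Complex.ofReal_mul, Complex.ofReal_re, mul_comm]

lemma isSymmetric_of_eigenbasis {κ : Type*} [Fintype κ] (h : OrthonormalBasis κ ℂ K)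
    {X : K →ₗ[ℂ] K} {x : κ → ℝ} (hX : ∀ k, X (h k) = (x k : ℂ) • h k) : X.IsSymmetric := by
  intro v w
  rw [apply_eq_sum_of_eigenbasis h hX, apply_eq_sum_of_eigenbasis h hX, sum_inner, inner_sum]
  refine Finset.sum_congr rfl fun k _ => ?_
  rw [inner_smul_right, inner_smul_left, map_mul, Complex.conj_ofReal, inner_conj_symm]
  ring

lemma exists_linearMap_of_eigenbasis {κ : Type*} [Fintype κ] (h : OrthonormalBasis κ ℂ K)
    (x : κ → ℝ) : ∃ X : K →ₗ[ℂ] K, ∀ k, X (h k) = (x k : ℂ) • h k := by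
  refine ⟨h.toBasis.constr ℂ fun k => (x k : ℂ) • h k, fun k => ?_⟩
  conv_lhs => rw [← h.coe_toBasis, h.toBasis.constr_basis]
  rw [h.coe_toBasis]

variable [FiniteDimensional ℂ K]

/-- Diagonalization, with nonincreasing eigenvalues. -/
lemma exists_eigenbasis {X : K →ₗ[ℂ] K} (hX : X.IsSymmetric) (hpos : ∀ v, 0 ≤ (⟪v, X v⟫_ℂ).re) :
    ∃ (h : OrthonormalBasis (Fin (Module.finrank ℂ K)) ℂ K) (x : Fin (Module.finrank ℂ K) → ℝ),
      Antitone x ∧ (∀ k, 0 ≤ x k) ∧ ∀ k, X (h k) = (x k : ℂ) • h k := by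
  refine ⟨hX.eigenvectorBasis rfl, hX.eigenvalues rfl, hX.eigenvalues_antitone rfl, fun k => ?_,
    fun k => hX.apply_eigenvectorBasis rfl k⟩
  have := hpos (hX.eigenvectorBasis rfl k)
  rw [hX.apply_eigenvectorBasis rfl k, inner_smul_right] at this
  simpa using this

/-- The operator `B* C B` on the finite-dimensional space `K`. -/
lemma exists_pullback_eigenbasis (B : K →ₗ[ℂ] H) {C : H →L[ℂ] H} (hC : 0 ≤ C) :
    ∃ (X : K →ₗ[ℂ] K) (h : OrthonormalBasis (Fin (Module.finrank ℂ K)) ℂ K)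
      (x : Fin (Module.finrank ℂ K) → ℝ), (∀ v w, ⟪v, X w⟫_ℂ = ⟪B v, C (B w)⟫_ℂ) ∧
      Antitone x ∧ (∀ k, 0 ≤ x k) ∧ ∀ k, X (h k) = (x k : ℂ) • h k := by
  have : CompleteSpace K := FiniteDimensional.complete ℂ K
  set X : K →ₗ[ℂ] K :=
    (ContinuousLinearMap.adjoint (LinearMap.toContinuousLinearMap B)).toLinearMap ∘ₗ
      C.toLinearMap ∘ₗ B with hXdef
  have hXi : ∀ v w, ⟪v, X w⟫_ℂ = ⟪B v, C (B w)⟫_ℂ := by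
    intro v w
    simp [hXdef, ContinuousLinearMap.adjoint_inner_right]
  have hsymm := ((ContinuousLinearMap.nonneg_iff_isPositive C).1 hC).isSymmetric
  have hXs : X.IsSymmetric := by
    intro v w
    rw [hXi, ← inner_conj_symm, hXi, inner_conj_symm]
    exact hsymm _ _
  obtain ⟨h, x, h1, h2, h3⟩ := exists_eigenbasis hXs fun v => by
    rw [hXi]; exact re_inner_apply_self_nonneg hC _
  exact ⟨X, h, x, hXi, h1, h2, h3⟩

/-- The joint concavity of `(A, Z) ↦ (1 / p) tr B* A ^ p B Z ^ (1 - p) + (1 - 1 / p) tr Z`, for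
`Z₀` and `Z₁` given by their spectral decompositions. -/
lemma exists_sum_youngFun_concave {κ₀ κ₁ : Type*} [Fintype κ₀] [Fintype κ₁]
    (b₀ : OrthonormalBasis κ₀ ℂ K) (b₁ : OrthonormalBasis κ₁ ℂ K)
    {u₀ : κ₀ → ℝ} {u₁ : κ₁ → ℝ} {s t : ℝ} (hs : 0 ≤ s) (ht : 0 ≤ t)
    (hu₀ : ∀ i, 0 ≤ u₀ i) (hu₁ : ∀ i, 0 ≤ u₁ i) (H : Type*) [NormedAddCommGroup H]
    [InnerProductSpace ℂ H] [CompleteSpace H] :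
    ∃ (b : OrthonormalBasis (Fin (Module.finrank ℂ K)) ℂ K) (u : Fin (Module.finrank ℂ K) → ℝ),
      (∀ j, 0 ≤ u j) ∧
      (∀ w, (∀ i, u₀ i = 0 ∨ ⟪b₀ i, w⟫_ℂ = 0) → (∀ i, u₁ i = 0 ∨ ⟪b₁ i, w⟫_ℂ = 0) →
        ∀ j, u j = 0 ∨ ⟪w, b j⟫_ℂ = 0) ∧
      ∀ (B : K →ₗ[ℂ] H) {A A₀ A₁ : H →L[ℂ] H} (_ : A = s • A₀ + t • A₁)
        {p : ℝ} (_ : -1 ≤ p) (_ : p ≤ 1) (_ : p ≠ 0) (_ : 0 ≤ A₀) (_ : 0 ≤ A₁)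
        (_ : p < 0 → IsUnit A) (_ : p < 0 → IsUnit A₀) (_ : p < 0 → IsUnit A₁),
        s * ∑ i, youngFun p (⟪B (b₀ i), (A₀ ^ p : H →L[ℂ] H) (B (b₀ i))⟫_ℂ).re (u₀ i) +
          t * ∑ i, youngFun p (⟪B (b₁ i), (A₁ ^ p : H →L[ℂ] H) (B (b₁ i))⟫_ℂ).re (u₁ i) ≤
        ∑ i, youngFun p (⟪B (b i), (A ^ p : H →L[ℂ] H) (B (b i))⟫_ℂ).re (u i) := by
  obtain ⟨Z₀, hZ₀⟩ := exists_linearMap_of_eigenbasis b₀ u₀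
  obtain ⟨Z₁, hZ₁⟩ := exists_linearMap_of_eigenbasis b₁ u₁
  set Z : K →ₗ[ℂ] K := (s : ℂ) • Z₀ + (t : ℂ) • Z₁ with hZ
  have hsym : Z.IsSymmetric := by
    intro v w
    have h0 := isSymmetric_of_eigenbasis b₀ hZ₀ v w
    have h1 := isSymmetric_of_eigenbasis b₁ hZ₁ v w
    simp only [hZ, LinearMap.add_apply, LinearMap.smul_apply, inner_add_left, inner_add_right,
      inner_smul_left, inner_smul_right, Complex.conj_ofReal, h0, h1]
  have hpos : ∀ v, 0 ≤ (⟪v, Z v⟫_ℂ).re := by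
    intro v
    have h0 : 0 ≤ (⟪v, Z₀ v⟫_ℂ).re := by
      rw [re_inner_apply_eq_sum_of_eigenbasis b₀ hZ₀]
      exact Finset.sum_nonneg fun k _ => mul_nonneg (sq_nonneg _) (hu₀ k)
    have h1 : 0 ≤ (⟪v, Z₁ v⟫_ℂ).re := by
      rw [re_inner_apply_eq_sum_of_eigenbasis b₁ hZ₁]
      exact Finset.sum_nonneg fun k _ => mul_nonneg (sq_nonneg _) (hu₁ k)
    simp only [hZ, LinearMap.add_apply, LinearMap.smul_apply, inner_add_right,
      inner_smul_right, Complex.add_re, Complex.re_ofReal_mul]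
    exact add_nonneg (mul_nonneg hs h0) (mul_nonneg ht h1)
  obtain ⟨b, u, -, hu, hb⟩ := exists_eigenbasis hsym hpos
  refine ⟨b, u, hu, fun w h0 h1 j => ?_, ?_⟩
  -- A vector in both kernels lies in `ker Z`, hence is orthogonal to eigenvectors of `Z` with
  -- nonzero eigenvalue. This handles a singular `B` when `p < 0`.
  · have e0 : Z₀ w = 0 := by
      rw [apply_eq_sum_of_eigenbasis b₀ hZ₀]
      refine Finset.sum_eq_zero fun i _ => ?_
      rcases h0 i with h | h <;> simp [h]
    have e1 : Z₁ w = 0 := by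
      rw [apply_eq_sum_of_eigenbasis b₁ hZ₁]
      refine Finset.sum_eq_zero fun i _ => ?_
      rcases h1 i with h | h <;> simp [h]
    have e : ⟪w, Z (b j)⟫_ℂ = 0 := by
      rw [← hsym w (b j), hZ]
      simp [e0, e1]
    rw [hb, inner_smul_right, mul_eq_zero] at e
    exact e.imp (fun h => by exact_mod_cast h) id
  · intro B A A₀ A₁ hA p hp1 hp2 hp3 pA₀ pA₁ sA sA₀ sA₁
    have pA : 0 ≤ A := hA ▸ add_nonneg (smul_nonneg hs pA₀) (smul_nonneg ht pA₁)
    exact sum_youngFun_concave b b₀ b₁ hb hZ₀ hZ₁ hZ hs ht hu hu₀ hu₁ B hA hp1 hp2 hp3 pA pA₀ pA₁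
      sA sA₀ sA₁

end Eigenbases

/-! ### Traces of bounded operators and finite-dimensional compressions. -/

section PositiveExponent

variable {H : Type*} [NormedAddCommGroup H] [InnerProductSpace ℂ H] [CompleteSpace H]

lemma re_inner_le_of_le {S T : H →L[ℂ] H} (h : S ≤ T) (v : H) :
    (⟪v, S v⟫_ℂ).re ≤ (⟪v, T v⟫_ℂ).re := by
  have := re_inner_apply_self_nonneg (sub_nonneg.2 h) v
  rw [sub_apply, inner_sub_right, Complex.sub_re] at this
  linarith

omit [CompleteSpace H] in
lemma ofReal_norm_sq_eq_tsum {ι : Type*} (e : HilbertBasis ι ℂ H) (y : H) :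
    ENNReal.ofReal (‖y‖ ^ 2) = ∑' i, ENNReal.ofReal (‖⟪e i, y⟫_ℂ‖ ^ 2) := by
  have h := e.hasSum_inner_mul_inner y y
  have h2 : HasSum (fun i => ‖⟪e i, y⟫_ℂ‖ ^ 2) (‖y‖ ^ 2) := by
    have h3 := Complex.reCLM.hasSum h
    have h4 : Complex.reCLM ⟪y, y⟫_ℂ = ‖y‖ ^ 2 := by
      simpa using inner_self_eq_norm_sq (𝕜 := ℂ) y
    rw [h4] at h3
    convert h3 using 2 with i
    rw [← inner_conj_symm y, mul_comm, Complex.mul_conj, Complex.normSq_eq_norm_sq]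
    rfl
  rw [← h2.tsum_eq, ENNReal.ofReal_tsum_of_nonneg (fun i => sq_nonneg _) h2.summable]

lemma re_inner_eq_norm_sqrt_sq {S : H →L[ℂ] H} (hS : 0 ≤ S) (v : H) :
    (⟪v, S v⟫_ℂ).re = ‖CFC.sqrt S v‖ ^ 2 := by
  have hsym := ((ContinuousLinearMap.nonneg_iff_isPositive _).1 (CFC.sqrt_nonneg S)).isSymmetric
  have h1 : S v = CFC.sqrt S (CFC.sqrt S v) := by
    rw [← mul_apply_eq_comp, CFC.sqrt_mul_sqrt_self S hS]
  have h2 := hsym v (CFC.sqrt S v)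
  rw [ContinuousLinearMap.coe_coe] at h2
  rw [h1, ← h2]
  simpa using inner_self_eq_norm_sq (𝕜 := ℂ) (CFC.sqrt S v)

lemma apply_eq_zero_of_re_inner_eq_zero {S : H →L[ℂ] H} (hS : 0 ≤ S) {v : H}
    (h : (⟪v, S v⟫_ℂ).re = 0) : S v = 0 := by
  rw [re_inner_eq_norm_sqrt_sq hS, sq_eq_zero_iff, norm_eq_zero] at h
  rw [← CFC.sqrt_mul_sqrt_self S hS, mul_apply_eq_comp, h, map_zero]

/-- The sum of `⟨gⱼ, S gⱼ⟩` over a finite orthonormal family is at most the trace of `S ≥ 0`. -/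
lemma sum_re_inner_le_posTrace {ι κ : Type*} [Fintype κ] (e : HilbertBasis ι ℂ H) {g : κ → H}
    (hg : Orthonormal ℂ g) {S : H →L[ℂ] H} (hS : 0 ≤ S) :
    ENNReal.ofReal (∑ j, (⟪g j, S (g j)⟫_ℂ).re) ≤ posTrace e S := by
  set R := CFC.sqrt S with hR
  have hR0 : 0 ≤ R := CFC.sqrt_nonneg S
  have hsym := ((ContinuousLinearMap.nonneg_iff_isPositive R).1 hR0).isSymmetric
  have hRR : ∀ v, (⟪v, S v⟫_ℂ).re = ‖R v‖ ^ 2 := re_inner_eq_norm_sqrt_sq hS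
  unfold posTrace
  simp only [hRR]
  rw [ENNReal.ofReal_sum_of_nonneg fun j _ => sq_nonneg _]
  -- Expand in `e` and exchange the sums; for fixed `i`, symmetry of `R` and Bessel's inequality for
  -- `R (e i)` finish.
  simp only [ofReal_norm_sq_eq_tsum e (R (g _))]
  rw [← Summable.tsum_finsetSum fun j _ => ENNReal.summable]
  refine ENNReal.tsum_le_tsum fun i => ?_
  rw [← ENNReal.ofReal_sum_of_nonneg fun j _ => sq_nonneg _]
  refine ENNReal.ofReal_le_ofReal ?_
  have h := hg.sum_inner_products_le (x := R (e i)) (s := Finset.univ)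
  refine le_trans (Finset.sum_le_sum fun j _ => le_of_eq ?_) h
  have h2 := hsym (e i) (g j)
  rw [ContinuousLinearMap.coe_coe] at h2
  rw [← h2, ← inner_conj_symm, RCLike.norm_conj]

lemma spectrum_subset_Icc {T : H →L[ℂ] H} (hT : 0 ≤ T) : spectrum ℝ T ⊆ Set.Icc 0 ‖T‖ := by
  intro x hx
  refine ⟨spectrum_nonneg_of_nonneg hT hx, ?_⟩
  calc x ≤ ‖x‖ := Real.le_norm_self x
    _ ≤ ‖T‖ * ‖(1 : H →L[ℂ] H)‖ := spectrum.norm_le_norm_mul_of_mem hx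
    _ ≤ ‖T‖ := mul_le_of_le_one_right (norm_nonneg T) ContinuousLinearMap.norm_id_le

/-- The operator form of Young's inequality. -/
lemma youngFun_re_inner_le {T : H →L[ℂ] H} (hT : 0 ≤ T) {p u : ℝ} (h₀ : 0 < p) (h₁ : p ≤ 1)
    (hu : 0 ≤ u) {v : H} (hv : ‖v‖ = 1) :
    youngFun p (⟪v, T v⟫_ℂ).re u ≤ (⟪v, (T ^ (1 / p) : H →L[ℂ] H) v⟫_ℂ).re := by
  have hop : ((1 / p) * u ^ (1 - p)) • T + algebraMap ℝ (H →L[ℂ] H) ((1 - 1 / p) * u) ≤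
      T ^ (1 / p) := by
    rw [CFC.rpow_eq_cfc_real hT]
    have hlhs : ((1 / p) * u ^ (1 - p)) • T + algebraMap ℝ (H →L[ℂ] H) ((1 - 1 / p) * u) =
        cfc (fun x : ℝ => youngFun p x u) T := by
      unfold youngFun
      rw [cfc_add_const _ _ T, ← cfc_const_mul_id _ T]
      congr 1
      exact cfc_congr fun x _ => by ring
    rw [hlhs]
    refine cfc_mono (fun x hx => youngFun_le_of_pos h₀ h₁ (spectrum_nonneg_of_nonneg hT hx) hu) ?_ ?_
    · unfold youngFun; fun_prop
    · exact ContinuousOn.rpow_const continuousOn_id fun x _ => .inr (one_div_pos.2 h₀).le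
  have := re_inner_le_of_le hop v
  refine le_trans (le_of_eq ?_) this
  rw [add_apply, smul_apply, inner_add_right, Complex.add_re,
    re_inner_real_smul, Algebra.algebraMap_eq_smul_one, smul_apply, re_inner_real_smul]
  have h1 : (⟪v, (1 : H →L[ℂ] H) v⟫_ℂ).re = 1 := by
    have := inner_self_eq_norm_sq (𝕜 := ℂ) v
    rw [hv] at this
    simpa using this
  rw [h1, youngFun]
  ring

/-- Compressing `T` to a finite-dimensional subspace that contains sufficiently many of the vectors
`T ^ m vᵢ` loses little of the partial trace of `T ^ r`. -/
lemma exists_submodule_sum_re_inner_rpow_le {κ : Type*} (F : Finset κ) {v : κ → H}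
    (hv : Orthonormal ℂ v) {T : H →L[ℂ] H} (hT : 0 ≤ T) {r δ : ℝ} (hr : 0 < r) (hδ : 0 < δ) :
    ∃ V : Submodule ℂ H, FiniteDimensional ℂ V ∧ ∀ K : Submodule ℂ H, V ≤ K →
      FiniteDimensional ℂ K → ∀ {n : ℕ} (X : K →ₗ[ℂ] K) (h : OrthonormalBasis (Fin n) ℂ K)
        (x : Fin n → ℝ), (∀ a b : K, ⟪a, X b⟫_ℂ = ⟪(a : H), T b⟫_ℂ) →
        (∀ k, X (h k) = (x k : ℂ) • h k) → (∀ k, 0 ≤ x k) →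
        ∑ i ∈ F, (⟪v i, (T ^ r : H →L[ℂ] H) (v i)⟫_ℂ).re ≤ ∑ k, x k ^ r + δ := by
  classical
  -- Replacing `T^r` by `π(T)` and `π(X)` by `X^r` costs `δ'` each for every index in `F`; the `+ 1`
  -- keeps the denominator positive.
  set δ' : ℝ := δ / (2 * F.card + 1) with hδ'
  have hden : (0 : ℝ) < 2 * F.card + 1 := by positivity
  have hδ'0 : 0 < δ' := div_pos hδ hden
  obtain ⟨π, hπ⟩ := exists_polynomial_near_of_continuousOn 0 ‖T‖ (fun y : ℝ => y ^ r)
    (ContinuousOn.rpow_const continuousOn_id fun x _ => .inr hr.le) δ' hδ'0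
  set d := π.natDegree with hd
  set V : Submodule ℂ H := Submodule.span ℂ
    (((F ×ˢ Finset.range (d + 1)).image fun a => (T ^ a.2) (v a.1) : Finset H) : Set H) with hV
  refine ⟨V, FiniteDimensional.span_finset ℂ _, fun K hVK hK n X h x hX hXh hx => ?_⟩
  have hmem : ∀ i ∈ F, ∀ m ≤ d, (T ^ m) (v i) ∈ K := fun i hi m hm => hVK <| by
    refine Submodule.subset_span ?_
    simp only [Finset.coe_image, Set.mem_image, Finset.mem_coe, Finset.mem_product,
      Finset.mem_range]
    exact ⟨(i, m), ⟨hi, Nat.lt_succ_of_le hm⟩, rfl⟩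
  have hXT : ∀ b : K, T b ∈ K → (X b : H) = T b := by
    intro b hb
    have : X b = ⟨T b, hb⟩ := ext_inner_left ℂ fun a => by rw [hX]; rfl
    rw [this]
  -- As `T^m (v i)` stays in `K` up to the degree of `π`, powers of the compression agree with those
  -- of `T` on `v i`, so `π(T)` and `π(X)` have the same diagonal entry there.
  have hpow : ∀ i (hi : i ∈ F), ∀ m (hm : m ≤ d),
      ((X ^ m) ⟨v i, hmem i hi 0 (Nat.zero_le d)⟩ : H) = (T ^ m) (v i) := by
    intro i hi m
    induction m with
    | zero => intro _; rfl
    | succ m ih =>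
      intro hm
      have e := ih (by omega)
      have hT' : T ((X ^ m) ⟨v i, hmem i hi 0 (Nat.zero_le d)⟩ : K) = (T ^ (m + 1)) (v i) := by
        rw [e, pow_succ', mul_apply_eq_comp]
      rw [pow_succ', Module.End.mul_apply, hXT _ (by rw [hT']; exact hmem i hi _ hm), hT']
  have hXm : ∀ m k, (X ^ m) (h k) = ((x k ^ m : ℝ) : ℂ) • h k := by
    intro m k
    induction m with
    | zero => simp
    | succ m ih => rw [pow_succ', Module.End.mul_apply, ih, map_smul, hXh, smul_smul]; push_cast; rfl
  have hxT : ∀ k, x k ∈ Set.Icc 0 ‖T‖ := by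
    intro k
    refine ⟨hx k, ?_⟩
    have h1 : x k = (⟪(h k : H), T (h k)⟫_ℂ).re := by
      rw [← hX, hXh, inner_smul_right]
      simp
    rw [h1]
    refine (Complex.re_le_norm _).trans ((norm_inner_le_norm _ _).trans ?_)
    have h2 : ‖(h k : H)‖ = 1 := h.orthonormal.1 k
    have h3 := T.le_opNorm (h k : H)
    rw [h2] at h3 ⊢
    linarith
  have hop : T ^ r ≤ Polynomial.aeval T π + algebraMap ℝ (H →L[ℂ] H) δ' := by
    rw [CFC.rpow_eq_cfc_real hT, ← cfc_polynomial π T, ← cfc_add_const _ _ T]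
    refine cfc_mono (fun y hy => ?_) ?_ ?_
    · have := abs_lt.1 (hπ y (spectrum_subset_Icc hT hy))
      linarith
    · exact ContinuousOn.rpow_const continuousOn_id fun x _ => .inr hr.le
    · fun_prop
  set a : κ → Fin n → ℝ := fun i k => if hi : i ∈ F then
    ‖⟪h k, (⟨v i, hmem i hi 0 (Nat.zero_le d)⟩ : K)⟫_ℂ‖ ^ 2 else 0 with ha
  have ha0 : ∀ i k, 0 ≤ a i k := by
    intro i k
    simp only [ha]
    split_ifs
    · exact sq_nonneg _
    · exact le_rfl
  have ha1 : ∀ i ∈ F, ∑ k, a i k = 1 := by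
    intro i hi
    simp only [ha, hi, dif_pos]
    rw [h.sum_sq_norm_inner_right]
    have := hv.1 i
    simp [this]
  -- By Bessel, each eigenvalue of `X` is counted with total weight at most one.
  have ha2 : ∀ k, ∑ i ∈ F, a i k ≤ 1 := by
    intro k
    have hB := hv.sum_inner_products_le (x := (h k : H)) (s := F)
    have h2 : ‖(h k : H)‖ = 1 := h.orthonormal.1 k
    rw [h2, one_pow] at hB
    refine le_trans (Finset.sum_le_sum fun i hi => le_of_eq ?_) hB
    simp only [ha, hi, dif_pos]
    rw [Submodule.coe_inner, ← inner_conj_symm, RCLike.norm_conj]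
  have hterm : ∀ i ∈ F, (⟪v i, (T ^ r : H →L[ℂ] H) (v i)⟫_ℂ).re ≤
      ∑ k, a i k * x k ^ r + 2 * δ' := by
    intro i hi
    have e1 := re_inner_le_of_le hop (v i)
    have e2 : (⟪v i, (algebraMap ℝ (H →L[ℂ] H) δ') (v i)⟫_ℂ).re = δ' := by
      rw [Algebra.algebraMap_eq_smul_one, smul_apply, re_inner_real_smul]
      have := inner_self_eq_norm_sq (𝕜 := ℂ) (v i)
      rw [hv.1 i] at this
      simp only [one_apply_eq_self]
      have h' : (⟪v i, v i⟫_ℂ).re = 1 := by simpa using this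
      rw [h', mul_one]
    have e3 : (⟪v i, (Polynomial.aeval T π) (v i)⟫_ℂ).re = ∑ k, a i k * π.eval (x k) := by
      have e4 : ∀ m ≤ d, (⟪v i, (T ^ m) (v i)⟫_ℂ).re = ∑ k, a i k * x k ^ m := by
        intro m hm
        rw [← hpow i hi m hm]
        have := re_inner_apply_eq_sum_of_eigenbasis h (hXm m) ⟨v i, hmem i hi 0 (Nat.zero_le d)⟩
        simp only [ha, hi, dif_pos]
        rw [← this]
        rfl
      rw [Polynomial.aeval_eq_sum_range, sum_apply, inner_sum, Complex.re_sum]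
      simp only [Polynomial.eval_eq_sum_range, Finset.mul_sum]
      rw [Finset.sum_comm]
      refine Finset.sum_congr rfl fun m hm => ?_
      rw [smul_apply, re_inner_real_smul, e4 m (by simpa [Nat.lt_succ_iff] using hm),
        Finset.mul_sum]
      exact Finset.sum_congr rfl fun k _ => by ring
    have e5 : ∑ k, a i k * π.eval (x k) ≤ ∑ k, a i k * x k ^ r + δ' := by
      have : ∑ k, a i k * π.eval (x k) ≤ ∑ k, (a i k * x k ^ r + a i k * δ') := by
        refine Finset.sum_le_sum fun k _ => ?_
        rw [← mul_add]
        refine mul_le_mul_of_nonneg_left ?_ (ha0 i k)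
        have := abs_lt.1 (hπ (x k) (hxT k))
        linarith
      rwa [Finset.sum_add_distrib, ← Finset.sum_mul, ha1 i hi, one_mul] at this
    rw [add_apply, inner_add_right, Complex.add_re, e2, e3] at e1
    linarith
  calc ∑ i ∈ F, (⟪v i, (T ^ r : H →L[ℂ] H) (v i)⟫_ℂ).re
      ≤ ∑ i ∈ F, (∑ k, a i k * x k ^ r + 2 * δ') := Finset.sum_le_sum hterm
    _ = ∑ k, (∑ i ∈ F, a i k) * x k ^ r + F.card * (2 * δ') := by
        rw [Finset.sum_add_distrib, Finset.sum_const, nsmul_eq_mul, Finset.sum_comm]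
        simp only [Finset.sum_mul]
    _ ≤ ∑ k, x k ^ r + δ := by
        refine add_le_add (Finset.sum_le_sum fun k _ =>
          mul_le_of_le_one_left (Real.rpow_nonneg (hx k) r) (ha2 k)) ?_
        rw [hδ']
        have : (F.card : ℝ) * (2 * (δ / (2 * F.card + 1))) =
            δ * ((2 * F.card) / (2 * F.card + 1)) := by ring
        rw [this]
        refine mul_le_of_le_one_right hδ.le ?_
        rw [div_le_one hden]
        linarith

end PositiveExponent

/-! ### Concavity for positive exponents. -/

section PositiveExponent

variable {H : Type*} [NormedAddCommGroup H] [InnerProductSpace ℂ H] [CompleteSpace H]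

lemma inner_sandwich (B C : H →L[ℂ] H) (v w : H) :
    ⟪v, (ContinuousLinearMap.adjoint B * C * B) w⟫_ℂ = ⟪B v, C (B w)⟫_ℂ := by
  rw [mul_apply_eq_comp, mul_apply_eq_comp, ContinuousLinearMap.adjoint_inner_right]

lemma sandwich_nonneg (B : H →L[ℂ] H) {C : H →L[ℂ] H} (hC : 0 ≤ C) :
    0 ≤ ContinuousLinearMap.adjoint B * C * B := by
  rw [ContinuousLinearMap.nonneg_iff_isPositive] at hC ⊢
  exact hC.adjoint_conj B

lemma sum_youngFun_eigenvalues {K : Type*} [NormedAddCommGroup K] [InnerProductSpace ℂ K]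
    {κ : Type*} [Fintype κ] {p : ℝ} (hp : p ≠ 0) (h : OrthonormalBasis κ ℂ K) {X : K →ₗ[ℂ] K}
    {x : κ → ℝ} (hX : ∀ k, X (h k) = (x k : ℂ) • h k) (hx : ∀ k, 0 ≤ x k) {y : κ → ℝ}
    (hy : ∀ k, y k = (⟪h k, X (h k)⟫_ℂ).re) :
    ∑ k, youngFun p (y k) (x k ^ (1 / p)) = ∑ k, x k ^ (1 / p) := by
  refine Finset.sum_congr rfl fun k _ => ?_
  have : y k = x k := by
    rw [hy, hX, inner_smul_right]
    simp
  rw [this, youngFun_rpow hp (hx k)]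

omit [CompleteSpace H] in
/-- To bound a combination of traces, it is enough to bound the partial sums up to a small error. -/
lemma combination_posTrace_le {ι : Type*} (e : HilbertBasis ι ℂ H) {S₀ S₁ : H →L[ℂ] H}
    (h₀ : 0 ≤ S₀) (h₁ : 0 ≤ S₁) {s t : ℝ} (hs : 0 ≤ s) (ht : 0 ≤ t) (hst : s + t = 1) {c : ℝ≥0∞}
    (h : ∀ (F : Finset ι) (δ : ℝ), 0 < δ → ∃ a₀ a₁ : ℝ,
      ∑ i ∈ F, (⟪e i, S₀ (e i)⟫_ℂ).re ≤ a₀ + δ ∧ ∑ i ∈ F, (⟪e i, S₁ (e i)⟫_ℂ).re ≤ a₁ + δ ∧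
      ENNReal.ofReal (s * a₀ + t * a₁) ≤ c) :
    ENNReal.ofReal s * posTrace e S₀ + ENNReal.ofReal t * posTrace e S₁ ≤ c := by
  unfold posTrace
  rw [← ENNReal.tsum_mul_left, ← ENNReal.tsum_mul_left,
    ← ENNReal.summable.tsum_add ENNReal.summable, ENNReal.tsum_eq_iSup_sum]
  refine iSup_le fun F => ENNReal.le_of_forall_pos_le_add fun δ hδ _ => ?_
  obtain ⟨a₀, a₁, b₀, b₁, hc⟩ := h F δ hδ
  have n₀ : ∀ i, 0 ≤ (⟪e i, S₀ (e i)⟫_ℂ).re := fun i => re_inner_apply_self_nonneg h₀ _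
  have n₁ : ∀ i, 0 ≤ (⟪e i, S₁ (e i)⟫_ℂ).re := fun i => re_inner_apply_self_nonneg h₁ _
  calc ∑ i ∈ F, (ENNReal.ofReal s * ENNReal.ofReal (⟪e i, S₀ (e i)⟫_ℂ).re +
        ENNReal.ofReal t * ENNReal.ofReal (⟪e i, S₁ (e i)⟫_ℂ).re)
      = ENNReal.ofReal (s * ∑ i ∈ F, (⟪e i, S₀ (e i)⟫_ℂ).re +
          t * ∑ i ∈ F, (⟪e i, S₁ (e i)⟫_ℂ).re) := by
        rw [Finset.sum_add_distrib, ← Finset.mul_sum, ← Finset.mul_sum,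
          ENNReal.ofReal_add (mul_nonneg hs (Finset.sum_nonneg fun i _ => n₀ i))
            (mul_nonneg ht (Finset.sum_nonneg fun i _ => n₁ i)),
          ENNReal.ofReal_mul hs, ENNReal.ofReal_mul ht,
          ENNReal.ofReal_sum_of_nonneg fun i _ => n₀ i,
          ENNReal.ofReal_sum_of_nonneg fun i _ => n₁ i]
    _ ≤ ENNReal.ofReal (s * a₀ + t * a₁ + δ) := by
        refine ENNReal.ofReal_le_ofReal ?_
        have e₀ := mul_le_mul_of_nonneg_left b₀ hs
        have e₁ := mul_le_mul_of_nonneg_left b₁ ht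
        have e₂ : s * (δ : ℝ) + t * δ = δ := by rw [← add_mul, hst, one_mul]
        rw [mul_add] at e₀ e₁
        linarith
    _ ≤ c + δ := by
        refine ENNReal.ofReal_add_le.trans ?_
        rw [ENNReal.ofReal_coe_nnreal]
        gcongr

lemma posTrace_sandwich_concave {ι : Type*} (e : HilbertBasis ι ℂ H) (B : H →L[ℂ] H) {p : ℝ}
    (hp₀ : 0 < p) (hp₁ : p ≤ 1) {A₀ A₁ : H →L[ℂ] H} (h₀ : 0 ≤ A₀) (h₁ : 0 ≤ A₁) {s t : ℝ}
    (hs : 0 ≤ s) (ht : 0 ≤ t) (hst : s + t = 1) :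
    ENNReal.ofReal s *
        posTrace e ((ContinuousLinearMap.adjoint B * A₀ ^ p * B : H →L[ℂ] H) ^ (1 / p)) +
      ENNReal.ofReal t *
        posTrace e ((ContinuousLinearMap.adjoint B * A₁ ^ p * B : H →L[ℂ] H) ^ (1 / p)) ≤
      posTrace e ((ContinuousLinearMap.adjoint B * (s • A₀ + t • A₁) ^ p * B : H →L[ℂ] H) ^
        (1 / p)) := by
  have hr : 0 < 1 / p := one_div_pos.2 hp₀
  refine combination_posTrace_le e CFC.rpow_nonneg CFC.rpow_nonneg hs ht hst fun F δ hδ => ?_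
  obtain ⟨A, hA⟩ : ∃ A, A = s • A₀ + t • A₁ := ⟨_, rfl⟩
  rw [← hA]
  obtain ⟨V₀, hV₀, H₀⟩ := exists_submodule_sum_re_inner_rpow_le F e.orthonormal
    (sandwich_nonneg B (CFC.rpow_nonneg (a := A₀) (y := p))) hr hδ
  obtain ⟨V₁, hV₁, H₁⟩ := exists_submodule_sum_re_inner_rpow_le F e.orthonormal
    (sandwich_nonneg B (CFC.rpow_nonneg (a := A₁) (y := p))) hr hδ
  -- One space large enough for both compressions, so that `Z₀` and `Z₁` can be averaged.
  obtain ⟨K, hK⟩ : ∃ K : Submodule ℂ H, K = V₀ ⊔ V₁ := ⟨_, rfl⟩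
  have hKfin : FiniteDimensional ℂ K := hK ▸ Submodule.finiteDimensional_sup V₀ V₁
  obtain ⟨B', hB'⟩ : ∃ B' : K →ₗ[ℂ] H, ∀ v : K, B' v = B v :=
    ⟨B.toLinearMap ∘ₗ K.subtype, fun _ => rfl⟩
  obtain ⟨X₀, f₀, x₀, hX₀, -, hx₀, hf₀⟩ :=
    exists_pullback_eigenbasis B' (C := A₀ ^ p) CFC.rpow_nonneg
  obtain ⟨X₁, f₁, x₁, hX₁, -, hx₁, hf₁⟩ :=
    exists_pullback_eigenbasis B' (C := A₁ ^ p) CFC.rpow_nonneg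
  have b₀ := H₀ K (hK ▸ le_sup_left) hKfin X₀ f₀ x₀
    (fun a b => by rw [hX₀, inner_sandwich, hB', hB']) hf₀ hx₀
  have b₁ := H₁ K (hK ▸ le_sup_right) hKfin X₁ f₁ x₁
    (fun a b => by rw [hX₁, inner_sandwich, hB', hB']) hf₁ hx₁
  refine ⟨_, _, b₀, b₁, ?_⟩
  obtain ⟨g, u, hu, -, hconc⟩ := exists_sum_youngFun_concave f₀ f₁ hs ht
    (fun i => Real.rpow_nonneg (hx₀ i) (1 / p)) (fun i => Real.rpow_nonneg (hx₁ i) (1 / p)) H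
  have hpn : ¬ p < 0 := hp₀.not_gt
  have main := hconc B' hA (by linarith) hp₁ hp₀.ne' h₀ h₁ (fun h => absurd h hpn)
    (fun h => absurd h hpn) (fun h => absurd h hpn)
  rw [sum_youngFun_eigenvalues hp₀.ne' f₀ hf₀ hx₀ (fun k => by rw [hX₀]),
    sum_youngFun_eigenvalues hp₀.ne' f₁ hf₁ hx₁ (fun k => by rw [hX₁])] at main
  have hgo : Orthonormal ℂ (fun j => (g j : H)) :=
    g.orthonormal.comp_linearIsometry K.subtypeₗᵢ
  -- The operator for `A` need not be compressed: Young's inequality on `H` is tested on the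
  -- orthonormal vectors `g j`.
  refine le_trans (ENNReal.ofReal_le_ofReal (main.trans (Finset.sum_le_sum fun j _ => ?_)))
    (sum_re_inner_le_posTrace e hgo CFC.rpow_nonneg)
  have := youngFun_re_inner_le (sandwich_nonneg B (CFC.rpow_nonneg (a := A) (y := p))) hp₀ hp₁
    (hu j) (hgo.1 j)
  rwa [inner_sandwich, ← hB'] at this

end PositiveExponent

/-! ### The real-valued statement in finite dimension. -/

section FiniteDimensional

variable {H : Type*} [NormedAddCommGroup H] [InnerProductSpace ℂ H] [CompleteSpace H]
  [FiniteDimensional ℂ H]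

omit [CompleteSpace H] in
lemma spectrum_subset_range_of_eigenbasis {κ : Type*} [Fintype κ] (h : OrthonormalBasis κ ℂ H)
    {T : H →L[ℂ] H} {x : κ → ℝ} (hT : ∀ k, T (h k) = (x k : ℂ) • h k) :
    spectrum ℝ T ⊆ Set.range x := by
  intro l hl
  by_contra hne
  have hx : ∀ k, l - x k ≠ 0 := fun k h0 => hne ⟨k, (sub_eq_zero.1 h0).symm⟩
  obtain ⟨S, hS⟩ := exists_linearMap_of_eigenbasis h fun k => (l - x k)⁻¹
  have hD : ∀ k, (algebraMap ℝ (H →L[ℂ] H) l - T) (h k) = ((l - x k : ℝ) : ℂ) • h k := by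
    intro k
    rw [sub_apply, hT, Algebra.algebraMap_eq_smul_one, smul_apply, Complex.ofReal_sub, sub_smul]
    rfl
  have key : ∀ D : H →L[ℂ] H, (∀ k, D (h k) = ((l - x k : ℝ) : ℂ) • h k) → IsUnit D := by
    intro D hD
    refine isUnit_iff_exists.2 ⟨LinearMap.toContinuousLinearMap S, ?_, ?_⟩ <;>
    · refine ContinuousLinearMap.coe_inj.1 (h.toBasis.ext fun k => ?_)
      have hk : ((l : ℂ) - x k) ≠ 0 := by exact_mod_cast hx k
      simp [hS, hD, smul_smul, hk]
  exact hl (key _ hD)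

lemma rpow_apply_eigenbasis {κ : Type*} [Fintype κ] (h : OrthonormalBasis κ ℂ H)
    {T : H →L[ℂ] H} (pT : 0 ≤ T) {x : κ → ℝ} (hT : ∀ k, T (h k) = (x k : ℂ) • h k) (r : ℝ) (k : κ) :
    (T ^ r : H →L[ℂ] H) (h k) = ((x k ^ r : ℝ) : ℂ) • h k := by
  classical
  -- Interpolation at the eigenvalues agrees with `y^r` on the finite spectrum. For `r < 0` the real
  -- convention `0^r = 0` gives the power on the range and `0` on the kernel.
  set π : Polynomial ℝ := Lagrange.interpolate (Finset.univ.image x) id fun y => y ^ r with hπ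
  have hev : ∀ k, π.eval (x k) = x k ^ r := fun k =>
    Lagrange.eval_interpolate_at_node (fun y : ℝ => y ^ r) (v := id)
      (Function.injective_id.injOn) (Finset.mem_image_of_mem x (Finset.mem_univ k))
  have e : T ^ r = Polynomial.aeval T π := by
    rw [CFC.rpow_eq_cfc_real pT, ← cfc_polynomial π T]
    refine cfc_congr fun y hy => ?_
    obtain ⟨k, rfl⟩ := spectrum_subset_range_of_eigenbasis h hT hy
    exact (hev k).symm
  have hm : ∀ m : ℕ, (T ^ m) (h k) = ((x k ^ m : ℝ) : ℂ) • h k := by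
    intro m
    induction m with
    | zero => simp
    | succ m ih => rw [pow_succ', mul_apply_eq_comp, ih, map_smul, hT, smul_smul]; push_cast; rfl
  rw [e, Polynomial.aeval_eq_sum_range, sum_apply, ← hev, Polynomial.eval_eq_sum_range,
    Complex.ofReal_sum, Finset.sum_smul]
  refine Finset.sum_congr rfl fun m _ => ?_
  rw [smul_apply, hm, Complex.ofReal_mul, mul_smul]
  rfl

lemma re_trace_rpow_eq_sum {κ : Type*} [Fintype κ] (h : OrthonormalBasis κ ℂ H)
    {T : H →L[ℂ] H} (pT : 0 ≤ T) {x : κ → ℝ} (hT : ∀ k, T (h k) = (x k : ℂ) • h k) (r : ℝ) :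
    (LinearMap.trace ℂ H ((T ^ r : H →L[ℂ] H) : H →ₗ[ℂ] H)).re = ∑ k, x k ^ r := by
  rw [LinearMap.trace_eq_sum_inner _ h, Complex.re_sum]
  refine Finset.sum_congr rfl fun k _ => ?_
  rw [ContinuousLinearMap.coe_coe, rpow_apply_eigenbasis h pT hT, inner_smul_right,
    OrthonormalBasis.inner_eq_one, mul_one, Complex.ofReal_re]

/-- Diagonalization of `B* A ^ p B` on a finite-dimensional space. -/
lemma exists_sandwich_eigenbasis (B : H →L[ℂ] H) (A : H →L[ℂ] H) (p : ℝ) :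
    ∃ (X : H →ₗ[ℂ] H) (h : OrthonormalBasis (Fin (Module.finrank ℂ H)) ℂ H)
      (x : Fin (Module.finrank ℂ H) → ℝ),
      (∀ v w, ⟪v, X w⟫_ℂ = ⟪B v, (A ^ p : H →L[ℂ] H) (B w)⟫_ℂ) ∧ (∀ k, 0 ≤ x k) ∧
      (∀ k, X (h k) = (x k : ℂ) • h k) ∧
      (LinearMap.trace ℂ H (((ContinuousLinearMap.adjoint B * A ^ p * B) ^ (1 / p) :
        H →L[ℂ] H) : H →ₗ[ℂ] H)).re = ∑ k, x k ^ (1 / p) := by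
  obtain ⟨X, h, x, hX, -, hx, hh⟩ :=
    exists_pullback_eigenbasis B.toLinearMap (C := A ^ p) CFC.rpow_nonneg
  refine ⟨X, h, x, hX, hx, hh, re_trace_rpow_eq_sum h (sandwich_nonneg B CFC.rpow_nonneg) ?_ _⟩
  intro k
  rw [← hh]
  refine ext_inner_left ℂ fun v => ?_
  rw [inner_sandwich, hX]
  rfl

omit [FiniteDimensional ℂ H] in
-- `A^p` is injective for `A > 0`, so the kernel of `B* A^p B` is that of `B` and does not depend on
-- `A`.
lemma sandwich_eigenvector_zero {A B : H →L[ℂ] H} (hA : IsStrictlyPositive A) {p : ℝ}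
    {X : H →ₗ[ℂ] H} (hX : ∀ v w, ⟪v, X w⟫_ℂ = ⟪B v, (A ^ p : H →L[ℂ] H) (B w)⟫_ℂ) {w : H}
    (hw : X w = 0) : B w = 0 := by
  have h1 : (A ^ p : H →L[ℂ] H) (B w) = 0 := by
    refine apply_eq_zero_of_re_inner_eq_zero CFC.rpow_nonneg ?_
    rw [← hX, hw, inner_zero_right, Complex.zero_re]
  have h3 := congrArg (fun S : H →L[ℂ] H => S (B w)) (CFC.rpow_neg_mul_rpow p hA)
  simpa [mul_apply_eq_comp, h1] using h3.symm

omit [FiniteDimensional ℂ H] in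
lemma sandwich_eigenvector_orthogonal {A B : H →L[ℂ] H} {p : ℝ} (hp : p ≠ 0) {X : H →ₗ[ℂ] H}
    (hX : ∀ v w, ⟪v, X w⟫_ℂ = ⟪B v, (A ^ p : H →L[ℂ] H) (B w)⟫_ℂ) {f w : H} {x : ℝ}
    (hf : X f = (x : ℂ) • f) (hw : B w = 0) : x ^ (1 / p) = 0 ∨ ⟪f, w⟫_ℂ = 0 := by
  have h := hX w f
  rw [hw, inner_zero_left, hf, inner_smul_right, mul_eq_zero] at h
  rcases h with h | h
  · left
    have : x = 0 := by exact_mod_cast h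
    rw [this, Real.zero_rpow (one_div_ne_zero hp)]
  · right
    rw [← inner_conj_symm, h, map_zero]

lemma concaveOn_re_trace_sandwich (B : H →L[ℂ] H) {p : ℝ}
    (hp_lower : -1 ≤ p) (hp_upper : p ≤ 1) (hp_ne : p ≠ 0) :
    ConcaveOn ℝ {A : H →L[ℂ] H | IsStrictlyPositive A} (fun A : H →L[ℂ] H =>
        (LinearMap.trace ℂ H
          (((ContinuousLinearMap.adjoint B * A ^ p * B) ^ (1 / p) : H →L[ℂ] H) :
            H →ₗ[ℂ] H)).re) := by
  have hconv : Convex ℝ {A : H →L[ℂ] H | IsStrictlyPositive A} := by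
    intro A hA A' hA' s t hs ht hst
    rcases hs.eq_or_lt with rfl | hs
    · obtain rfl : t = 1 := by linarith
      simpa using hA'
    · exact (IsStrictlyPositive.smul hs hA).add_nonneg (smul_nonneg ht hA'.nonneg)
  refine ⟨hconv, ?_⟩
  intro A₀ hA₀ A₁ hA₁ s t hs ht hst
  have hA := hconv hA₀ hA₁ hs ht hst
  set A := s • A₀ + t • A₁ with hAdef
  obtain ⟨X₀, f₀, x₀, hX₀, hx₀, hf₀, htr₀⟩ := exists_sandwich_eigenbasis B A₀ p
  obtain ⟨X₁, f₁, x₁, hX₁, hx₁, hf₁, htr₁⟩ := exists_sandwich_eigenbasis B A₁ p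
  obtain ⟨X, h, x, hX, hx, hh, htr⟩ := exists_sandwich_eigenbasis B A p
  simp only [smul_eq_mul]
  rw [htr₀, htr₁, htr]
  obtain ⟨g, u, hu, hker, hconc⟩ := exists_sum_youngFun_concave f₀ f₁ hs ht
    (fun i => Real.rpow_nonneg (hx₀ i) (1 / p)) (fun i => Real.rpow_nonneg (hx₁ i) (1 / p)) H
  have main := hconc B.toLinearMap hAdef hp_lower hp_upper hp_ne hA₀.nonneg hA₁.nonneg
    (fun _ => hA.isUnit) (fun _ => hA₀.isUnit) (fun _ => hA₁.isUnit)
  rw [sum_youngFun_eigenvalues hp_ne f₀ hf₀ hx₀ (fun k => by rw [hX₀]; rfl),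
    sum_youngFun_eigenvalues hp_ne f₁ hf₁ hx₁ (fun k => by rw [hX₁]; rfl)] at main
  refine main.trans (sum_youngFun_le_sum_rpow g h (fun j => ?_) fun j k => ?_)
  · rw [← re_inner_apply_eq_sum_of_eigenbasis h hh, hX]
    rfl
  rcases lt_or_gt_of_ne hp_ne with hneg | hpos
  · rcases (hx k).eq_or_lt with h0 | h0
    -- Young's inequality may fail at eigenvalue `0`. But `h k ∈ ker B` is then annihilated by `Z₀`
    -- and `Z₁`, so either `u j = 0` or the overlap with `g j` vanishes.
    · have hBk : B (h k) = 0 := sandwich_eigenvector_zero hA hX (by rw [hh, ← h0]; simp)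
      have hz₀ : ∀ i, x₀ i ^ (1 / p) = 0 ∨ ⟪f₀ i, h k⟫_ℂ = 0 := fun i =>
        sandwich_eigenvector_orthogonal hp_ne hX₀ (hf₀ i) hBk
      have hz₁ : ∀ i, x₁ i ^ (1 / p) = 0 ∨ ⟪f₁ i, h k⟫_ℂ = 0 := fun i =>
        sandwich_eigenvector_orthogonal hp_ne hX₁ (hf₁ i) hBk
      rcases hker (h k) hz₀ hz₁ j with h5 | h5
      · left
        rw [h5, youngFun_zero_right (by linarith)]
        exact Real.rpow_nonneg (hx k) _
      · exact .inr h5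
    · exact .inl (youngFun_le_of_neg hneg h0 (hu j))
  · exact .inl (youngFun_le_of_pos hpos hp_upper (hx k) (hu j))

end FiniteDimensional

/-! ### Quadratic forms of negative powers and their domains. -/

section NegativePowers

open Filter Topology

variable {H : Type*} [NormedAddCommGroup H] [InnerProductSpace ℂ H] [CompleteSpace H]

lemma isStrictlyPositive_add_smul_one {A : H →L[ℂ] H} (hA : 0 ≤ A) {ε : ℝ} (hε : 0 < ε) :
    IsStrictlyPositive (A + ε • (1 : H →L[ℂ] H)) :=
  (IsStrictlyPositive.smul hε isStrictlyPositive_one).nonneg_add hA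

/-- Operator antitonicity of `A ↦ A ^ p` for `-1 ≤ p ≤ 0`. -/
lemma rpow_le_rpow_of_exponent_nonpos {S T : H →L[ℂ] H} (hS : IsStrictlyPositive S) (h : S ≤ T)
    {p : ℝ} (hp₁ : -1 ≤ p) (hp₀ : p ≤ 0) : (T ^ p : H →L[ℂ] H) ≤ S ^ p := by
  have hT : IsStrictlyPositive T := by
    have := hS.add_nonneg (sub_nonneg.2 h)
    simpa using this
  have e : ∀ {R : H →L[ℂ] H}, IsStrictlyPositive R → R ^ p = (R ^ (-1 : ℝ)) ^ (-p) := by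
    intro R hR
    rw [CFC.rpow_rpow R (-1) (-p) (by norm_num) hR, neg_one_mul, neg_neg]
  rw [e hS, e hT]
  exact CFC.rpow_le_rpow ⟨by linarith, by linarith⟩ (CStarAlgebra.rpow_neg_one_le_rpow_neg_one h hS)

/-- The regularization `⟨x, (A + ε) ^ p x⟩` of the quadratic form of `A ^ p`. -/
noncomputable def regForm (A : H →L[ℂ] H) (p ε : ℝ) (x : H) : ℝ :=
  (⟪x, ((A + ε • 1) ^ p : H →L[ℂ] H) x⟫_ℂ).re

lemma regForm_nonneg (A : H →L[ℂ] H) (p ε : ℝ) (x : H) : 0 ≤ regForm A p ε x :=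
  re_inner_apply_self_nonneg CFC.rpow_nonneg x

lemma regForm_antitone {A : H →L[ℂ] H} (hA : 0 ≤ A) {p : ℝ} (hp₁ : -1 ≤ p) (hp₀ : p ≤ 0)
    (x : H) {ε ε' : ℝ} (hε : 0 < ε) (h : ε ≤ ε') : regForm A p ε' x ≤ regForm A p ε x := by
  refine re_inner_le_of_le (rpow_le_rpow_of_exponent_nonpos
    (isStrictlyPositive_add_smul_one hA hε) ?_ hp₁ hp₀) x
  have : (0 : H →L[ℂ] H) ≤ (ε' - ε) • (1 : H →L[ℂ] H) :=
    smul_nonneg (sub_nonneg.2 h) isStrictlyPositive_one.nonneg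
  rw [sub_smul] at this
  exact add_le_add_right (sub_nonneg.1 this) A

lemma regForm_pos {A : H →L[ℂ] H} (hA : 0 ≤ A) {p ε : ℝ} (hε : 0 < ε) {x : H} (hx : x ≠ 0) :
    0 < regForm A p ε x := by
  refine (regForm_nonneg A p ε x).lt_of_ne fun h => hx ?_
  have h1 := apply_eq_zero_of_re_inner_eq_zero CFC.rpow_nonneg h.symm
  have h3 := congrArg (fun S : H →L[ℂ] H => S x)
    (CFC.rpow_neg_mul_rpow p (isStrictlyPositive_add_smul_one hA hε))
  simpa [mul_apply_eq_comp, h1] using h3.symm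

lemma regForm_le_negPowForm (A : H →L[ℂ] H) (p : ℝ) {ε : ℝ} (hε : 0 < ε) (x : H) :
    ENNReal.ofReal (regForm A p ε x) ≤ negPowForm A p x :=
  le_iSup₂ (f := fun (ε : ℝ) (_ : 0 < ε) => ENNReal.ofReal (regForm A p ε x)) ε hε

lemma regForm_le_toReal {A : H →L[ℂ] H} {p : ℝ} {x : H} (h : negPowForm A p x ≠ ⊤) {ε : ℝ}
    (hε : 0 < ε) : regForm A p ε x ≤ (negPowForm A p x).toReal :=
  (ENNReal.ofReal_le_iff_le_toReal h).1 (regForm_le_negPowForm A p hε x)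

lemma regForm_le_of_negPowForm_le {A : H →L[ℂ] H} {p : ℝ} {x : H} {c : ℝ} (hc : 0 ≤ c)
    (h : negPowForm A p x ≤ ENNReal.ofReal c) {ε : ℝ} (hε : 0 < ε) : regForm A p ε x ≤ c :=
  (ENNReal.ofReal_le_ofReal_iff hc).1 ((regForm_le_negPowForm A p hε x).trans h)

/-- By monotonicity in `ε`, the supremum defining the form is the limit at `0⁺`. -/
lemma tendsto_regForm {A : H →L[ℂ] H} (hA : 0 ≤ A) {p : ℝ} (hp₁ : -1 ≤ p) (hp₀ : p ≤ 0) {x : H}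
    (h : negPowForm A p x ≠ ⊤) :
    Tendsto (fun ε => regForm A p ε x) (𝓝[>] 0) (𝓝 (negPowForm A p x).toReal) := by
  have key : Tendsto (fun ε => ENNReal.ofReal (regForm A p ε x)) (𝓝[>] 0)
      (𝓝 (negPowForm A p x)) := by
    refine tendsto_order.2 ⟨fun c hc => ?_, fun c hc => ?_⟩
    · obtain ⟨ε₀, hε₀⟩ := lt_iSup_iff.1 hc
      obtain ⟨hpos, hlt⟩ := lt_iSup_iff.1 hε₀
      filter_upwards [Ioo_mem_nhdsGT hpos] with ε hε
      exact hlt.trans_le (ENNReal.ofReal_le_ofReal (regForm_antitone hA hp₁ hp₀ x hε.1 hε.2.le))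
    · filter_upwards [self_mem_nhdsWithin] with ε hε
      exact (regForm_le_negPowForm A p hε x).trans_lt hc
  have := (ENNReal.tendsto_toReal h).comp key
  refine this.congr fun ε => ?_
  exact ENNReal.toReal_ofReal (regForm_nonneg A p ε x)

/-- The form domain of `A ^ p`. -/
noncomputable def negPowDomain (A : H →L[ℂ] H) (p : ℝ) : Submodule ℂ H where
  carrier := {x | ∃ c : ℝ, ∀ ε : ℝ, 0 < ε → regForm A p ε x ≤ c}
  zero_mem' := ⟨0, fun ε _ => by simp [regForm]⟩
  add_mem' := by
    rintro x y ⟨c, hc⟩ ⟨d, hd⟩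
    refine ⟨2 * c + 2 * d, fun ε hε => ?_⟩
    have e := fun v => re_inner_eq_norm_sqrt_sq
      (CFC.rpow_nonneg (a := A + ε • (1 : H →L[ℂ] H)) (y := p)) v
    have h1 := hc ε hε
    have h2 := hd ε hε
    unfold regForm at h1 h2 ⊢
    rw [e] at h1 h2 ⊢
    rw [map_add]
    have := norm_add_le (CFC.sqrt ((A + ε • (1 : H →L[ℂ] H)) ^ p) x)
      (CFC.sqrt ((A + ε • (1 : H →L[ℂ] H)) ^ p) y)
    nlinarith [sq_nonneg (‖CFC.sqrt ((A + ε • (1 : H →L[ℂ] H)) ^ p) x‖ -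
      ‖CFC.sqrt ((A + ε • (1 : H →L[ℂ] H)) ^ p) y‖), norm_nonneg
      (CFC.sqrt ((A + ε • (1 : H →L[ℂ] H)) ^ p) x + CFC.sqrt ((A + ε • (1 : H →L[ℂ] H)) ^ p) y)]
  smul_mem' := by
    rintro a x ⟨c, hc⟩
    refine ⟨‖a‖ ^ 2 * c, fun ε hε => ?_⟩
    have e := fun v => re_inner_eq_norm_sqrt_sq
      (CFC.rpow_nonneg (a := A + ε • (1 : H →L[ℂ] H)) (y := p)) v
    have h1 := hc ε hε
    unfold regForm at h1 ⊢
    rw [e] at h1 ⊢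
    rw [map_smul, norm_smul, mul_pow]
    exact mul_le_mul_of_nonneg_left h1 (sq_nonneg _)

lemma mem_negPowDomain {A : H →L[ℂ] H} {p : ℝ} {x : H} :
    x ∈ negPowDomain A p ↔ negPowForm A p x ≠ ⊤ := by
  constructor
  · rintro ⟨c, hc⟩
    refine ne_top_of_le_ne_top ENNReal.ofReal_ne_top (b := ENNReal.ofReal c) ?_
    exact iSup₂_le fun ε hε => ENNReal.ofReal_le_ofReal (hc ε hε)
  · exact fun h => ⟨_, fun ε hε => regForm_le_toReal h hε⟩

/-- From `s (A₀ + ε) ≤ A + ε`, operator antitonicity gives `(A + ε)^p ≤ s^p (A₀ + ε)^p`. -/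
lemma negPowDomain_le {A A₀ A₁ : H →L[ℂ] H} (h₀ : 0 ≤ A₀) (h₁ : 0 ≤ A₁) {s t : ℝ} (hs : 0 < s)
    (ht : 0 ≤ t) (hst : s + t = 1) (hA : A = s • A₀ + t • A₁) {p : ℝ} (hp₁ : -1 ≤ p)
    (hp₀ : p ≤ 0) : negPowDomain A₀ p ≤ negPowDomain A p := by
  rintro x ⟨c, hc⟩
  refine ⟨s ^ p * c, fun ε hε => ?_⟩
  have pos := isStrictlyPositive_add_smul_one h₀ hε
  have hle : s • (A₀ + ε • (1 : H →L[ℂ] H)) ≤ A + ε • (1 : H →L[ℂ] H) := by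
    have e : A + ε • (1 : H →L[ℂ] H) = s • (A₀ + ε • (1 : H →L[ℂ] H)) +
        t • (A₁ + ε • (1 : H →L[ℂ] H)) := by
      rw [hA, smul_add, smul_add, smul_smul, smul_smul, add_add_add_comm, ← add_smul, ← add_mul,
        hst, one_mul]
    rw [e]
    exact le_add_of_nonneg_right (smul_nonneg ht (isStrictlyPositive_add_smul_one h₁ hε).nonneg)
  have h := re_inner_le_of_le
    (rpow_le_rpow_of_exponent_nonpos (IsStrictlyPositive.smul hs pos) hle hp₁ hp₀) x
  rw [smul_rpow_of_nonneg hs pos.nonneg (.inr pos.isUnit), smul_apply, re_inner_real_smul] at h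
  exact h.trans (mul_le_mul_of_nonneg_left (hc ε hε) (Real.rpow_nonneg hs.le p))

/-- On a finite-dimensional subspace of the form domain, the form is given by an operator. -/
lemma exists_operator_of_negPowForm {A : H →L[ℂ] H} (hA : 0 ≤ A) {p : ℝ} (hp₁ : -1 ≤ p)
    (hp₀ : p ≤ 0) {K : Type*} [NormedAddCommGroup K] [InnerProductSpace ℂ K]
    [FiniteDimensional ℂ K] (B : K →ₗ[ℂ] H) (hB : ∀ v, negPowForm A p (B v) ≠ ⊤) :
    ∃ X : K →ₗ[ℂ] K, X.IsSymmetric ∧ ∀ v, (⟪v, X v⟫_ℂ).re = (negPowForm A p (B v)).toReal := by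
  have hY : ∀ ε : ℝ, ∃ Y : K →ₗ[ℂ] K,
      ∀ v w, ⟪v, Y w⟫_ℂ = ⟪B v, ((A + ε • 1) ^ p : H →L[ℂ] H) (B w)⟫_ℂ := fun ε => by
    obtain ⟨Y, -, -, hY, -⟩ :=
      exists_pullback_eigenbasis B (C := (A + ε • (1 : H →L[ℂ] H)) ^ p) CFC.rpow_nonneg
    exact ⟨Y, hY⟩
  choose Y hY using hY
  have hYs : ∀ ε, (Y ε).IsSymmetric := by
    intro ε v w
    have := ((ContinuousLinearMap.nonneg_iff_isPositive _).1
      (CFC.rpow_nonneg (a := A + ε • (1 : H →L[ℂ] H)) (y := p))).isSymmetric (B v) (B w)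
    rw [hY, ← inner_conj_symm, hY, inner_conj_symm]
    exact this
  have hdiag : ∀ v, Tendsto (fun ε => ⟪Y ε v, v⟫_ℂ) (𝓝[>] 0)
      (𝓝 ((negPowForm A p (B v)).toReal : ℂ)) := by
    intro v
    have h := (Complex.continuous_ofReal.tendsto _).comp (tendsto_regForm hA hp₁ hp₀ (hB v))
    refine h.congr fun ε => ?_
    have h1 : ⟪Y ε v, v⟫_ℂ = ⟪v, Y ε v⟫_ℂ := hYs ε v v
    have h2 : (starRingEnd ℂ) ⟪v, Y ε v⟫_ℂ = ⟪v, Y ε v⟫_ℂ := by rw [inner_conj_symm, h1]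
    rw [h1, ← Complex.conj_eq_iff_re.1 h2, hY]
    rfl
  -- Convergence is known only on the diagonal; polarization extends it to all matrix entries.
  have hlim : ∀ v w, ∃ l, Tendsto (fun ε => ⟪Y ε v, w⟫_ℂ) (𝓝[>] 0) (𝓝 l) := by
    intro v w
    simp only [inner_map_polarization' (Y _) v w]
    exact ⟨_, ((((hdiag _).sub (hdiag _)).sub ((hdiag _).const_mul _)).add
      ((hdiag _).const_mul _)).div_const _⟩
  have hlim' : ∀ w, ∃ l, Tendsto (fun ε => Y ε w) (𝓝[>] 0) (𝓝 l) := by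
    intro w
    have b := stdOrthonormalBasis ℂ K
    choose l hl using fun i => hlim (b i) w
    refine ⟨∑ i, l i • b i, ?_⟩
    have : (fun ε => Y ε w) = fun ε => ∑ i, ⟪Y ε (b i), w⟫_ℂ • b i := by
      ext ε
      conv_lhs => rw [← b.sum_repr' (Y ε w)]
      exact Finset.sum_congr rfl fun i _ => by rw [hYs ε (b i) w]
    rw [this]
    exact tendsto_finsetSum _ fun i _ => (hl i).smul_const _
  choose f hf using hlim'
  have hf' : Tendsto (fun ε w => Y ε w) (𝓝[>] 0) (𝓝 f) := tendsto_pi_nhds.2 hf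
  set X : K →ₗ[ℂ] K := linearMapOfTendsto f Y hf' with hX
  have hXf : ∀ w, X w = f w := fun _ => rfl
  refine ⟨X, fun v w => ?_, fun v => ?_⟩
  · have h1 : Tendsto (fun ε => ⟪Y ε v, w⟫_ℂ) (𝓝[>] 0) (𝓝 ⟪X v, w⟫_ℂ) :=
      (hf v).inner tendsto_const_nhds
    have h2 : Tendsto (fun ε => ⟪v, Y ε w⟫_ℂ) (𝓝[>] 0) (𝓝 ⟪v, X w⟫_ℂ) :=
      tendsto_const_nhds.inner (hf w)
    exact tendsto_nhds_unique h1 (h2.congr fun ε => (hYs ε v w).symm)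
  · have h1 : Tendsto (fun ε => ⟪Y ε v, v⟫_ℂ) (𝓝[>] 0) (𝓝 ⟪X v, v⟫_ℂ) :=
      (hf v).inner tendsto_const_nhds
    rw [re_inner_comm, tendsto_nhds_unique h1 (hdiag v), Complex.ofReal_re]

end NegativePowers

/-! ### Min-max values, eigenvalues and orthonormal families. -/

section MinMax

lemma ENNReal.rpow_le_rpow_of_exponent_nonpos {x y : ℝ≥0∞} {r : ℝ} (hr : r ≤ 0) (h : x ≤ y) :
    y ^ r ≤ x ^ r := by
  rw [← neg_neg r, ENNReal.rpow_neg y, ENNReal.rpow_neg x, ENNReal.inv_le_inv]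
  exact ENNReal.rpow_le_rpow h (neg_nonneg.2 hr)

variable {H : Type*} [NormedAddCommGroup H] [InnerProductSpace ℂ H]

/-- If `Q` is finite on the finite-dimensional space `K`, then its min-max values are at most the
eigenvalues of its restriction to `K`, in nondecreasing order. -/
lemma minMaxValue_le_eigenvalue {Q : H → ℝ≥0∞} {K : Submodule ℂ H} {n : ℕ}
    (h : OrthonormalBasis (Fin n) ℂ K) {X : K →ₗ[ℂ] K} {x : Fin n → ℝ} (hanti : Antitone x)
    (hX : ∀ k, X (h k) = (x k : ℂ) • h k)
    (hQ : ∀ v : K, Q v = ENNReal.ofReal (⟪v, X v⟫_ℂ).re) (k : Fin n) :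
    minMaxValue Q k ≤ ENNReal.ofReal (x k.rev) := by
  -- `c` selects the last `k + 1` indices, which carry the smallest eigenvalues because `x` is
  -- nonincreasing; the largest of these is `x k.rev`.
  obtain ⟨c, hc⟩ : ∃ c : Fin (k + 1) → Fin n, ∀ j, c j = (Fin.castLE k.2 j).rev := ⟨_, fun _ => rfl⟩
  have hcinj : Function.Injective c := fun i j hij => by
    rw [hc, hc, Fin.rev_inj] at hij
    exact Fin.castLE_injective _ hij
  have hfin : Module.finrank ℂ (Submodule.span ℂ (Set.range (h ∘ c))) = k + 1 := by
    rw [finrank_span_eq_card (h.orthonormal.comp c hcinj).linearIndependent, Fintype.card_fin]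
  refine iInf₂_le_of_le ((Submodule.span ℂ (Set.range (h ∘ c))).map K.subtype) ?_ ?_
  · rw [Submodule.finrank_map_subtype_eq, hfin]
  refine iSup_le fun v => iSup₂_le fun hv hv1 => ?_
  obtain ⟨w, hw, rfl⟩ := hv
  have hw1 : ‖w‖ = 1 := hv1
  rw [Submodule.subtype_apply, hQ]
  refine ENNReal.ofReal_le_ofReal ?_
  rw [re_inner_apply_eq_sum_of_eigenbasis h hX]
  calc ∑ m, ‖⟪h m, w⟫_ℂ‖ ^ 2 * x m ≤ ∑ m, ‖⟪h m, w⟫_ℂ‖ ^ 2 * x k.rev := by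
        refine Finset.sum_le_sum fun m _ => ?_
        by_cases hm : k.rev ≤ m
        · exact mul_le_mul_of_nonneg_left (hanti hm) (sq_nonneg _)
        · have h0 : ⟪h m, w⟫_ℂ = 0 := by
            have hle : Submodule.span ℂ (Set.range (h ∘ c)) ≤ (innerₛₗ ℂ (h m)).ker := by
              rw [Submodule.span_le]
              rintro _ ⟨j, rfl⟩
              refine h.orthonormal.2 fun e => hm ?_
              rw [e, hc, Fin.rev_le_rev]
              exact Nat.lt_succ_iff.1 j.2
            exact hle hw
          simp [h0]
    _ = x k.rev := by rw [← Finset.sum_mul, h.sum_sq_norm_inner_right, hw1]; simp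

lemma sum_rpow_le_negPowTrace {Q : H → ℝ≥0∞} {r : ℝ} (hr : r < 0) {K : Submodule ℂ H} {n : ℕ}
    (h : OrthonormalBasis (Fin n) ℂ K) {X : K →ₗ[ℂ] K} {x : Fin n → ℝ} (hanti : Antitone x)
    (hx : ∀ k, 0 < x k) (hX : ∀ k, X (h k) = (x k : ℂ) • h k)
    (hQ : ∀ v : K, Q v = ENNReal.ofReal (⟪v, X v⟫_ℂ).re) :
    ENNReal.ofReal (∑ k, x k ^ r) ≤ negPowTrace Q r := by
  rw [← Equiv.sum_comp Fin.revPerm,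
    ENNReal.ofReal_sum_of_nonneg fun k _ => Real.rpow_nonneg (hx _).le r]
  calc ∑ k : Fin n, ENNReal.ofReal (x (Fin.revPerm k) ^ r)
      ≤ ∑ k : Fin n, minMaxValue Q k ^ r := by
        refine Finset.sum_le_sum fun k _ => ?_
        rw [← ENNReal.ofReal_rpow_of_pos (hx _)]
        exact ENNReal.rpow_le_rpow_of_exponent_nonpos hr.le (minMaxValue_le_eigenvalue h hanti hX hQ k)
    _ = ∑ k ∈ Finset.range n, minMaxValue Q k ^ r :=
        (Finset.sum_range fun k => minMaxValue Q k ^ r).symm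
    _ ≤ negPowTrace Q r := ENNReal.sum_le_tsum _

/-- Upper bounds on the min-max values are realized by an orthonormal family. -/
lemma exists_orthonormal_le_of_minMaxValue_lt {Q : H → ℝ≥0∞} {y : ℕ → ℝ≥0∞} (F : Finset ℕ)
    (hF : ∀ n ∈ F, minMaxValue Q n < y n) :
    ∃ f : ℕ → H, Orthonormal ℂ (fun i : F => f i) ∧ ∀ n ∈ F, Q (f n) ≤ y n := by
  suffices ∃ f : ℕ → H, (∀ n ∈ F, ‖f n‖ = 1) ∧
      (∀ m ∈ F, ∀ n ∈ F, m ≠ n → ⟪f m, f n⟫_ℂ = 0) ∧ ∀ n ∈ F, Q (f n) ≤ y n by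
    obtain ⟨f, h1, h2, h3⟩ := this
    exact ⟨f, ⟨fun i => h1 i i.2, fun i j hij => h2 i i.2 j j.2 fun e => hij (Subtype.ext e)⟩, h3⟩
  induction F using Finset.induction_on_max with
  | empty => exact ⟨0, by simp, by simp, by simp⟩
  | insert n F hmax ih =>
    obtain ⟨f, h1, h2, h3⟩ := ih fun m hm => hF m (Finset.mem_insert_of_mem hm)
    have hlt := hF n (Finset.mem_insert_self n F)
    obtain ⟨V, hV⟩ := iInf_lt_iff.1 hlt
    obtain ⟨hdim, hV⟩ := iInf_lt_iff.1 hV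
    have : FiniteDimensional ℂ V := FiniteDimensional.of_finrank_pos (by omega)
    have hcard : F.card ≤ n := by
      simpa using Finset.card_le_card fun m hm => Finset.mem_range.2 (hmax m hm)
    obtain ⟨L, hL⟩ : ∃ L : V →ₗ[ℂ] (F → ℂ), ∀ v i, L v i = ⟪f i, (v : H)⟫_ℂ :=
      ⟨LinearMap.pi fun i : F => innerₛₗ ℂ (f i) ∘ₗ V.subtype, fun _ _ => rfl⟩
    -- The trial space `V` has dimension `n + 1`, and at most `n` vectors were chosen before, so `V`
    -- contains a nonzero vector orthogonal to all of them.
    have hker : LinearMap.ker L ≠ ⊥ := LinearMap.ker_ne_bot_of_finrank_lt (by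
      rw [Module.finrank_fintype_fun_eq_card, Fintype.card_coe, hdim]; omega)
    obtain ⟨v, hv, hv0⟩ := (Submodule.ne_bot_iff _).1 hker
    obtain ⟨w, hw⟩ : ∃ w : H, w = ((‖v‖ : ℂ)⁻¹ • v : V) := ⟨_, rfl⟩
    have hw1 : ‖w‖ = 1 := by
      have : ‖v‖ ≠ 0 := by simpa using hv0
      rw [hw, Submodule.coe_smul, norm_smul, norm_inv, Complex.norm_real, norm_norm]
      exact inv_mul_cancel₀ this
    have hworth : ∀ m ∈ F, ⟪f m, w⟫_ℂ = 0 := by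
      intro m hm
      have := congrFun (LinearMap.mem_ker.1 hv) ⟨m, hm⟩
      rw [hL] at this
      rw [hw, Submodule.coe_smul, inner_smul_right, this]
      simp
    have hne : ∀ m ∈ F, m ≠ n := fun m hm => (hmax m hm).ne
    have hup : ∀ m ∈ F, Function.update f n w m = f m := fun m hm =>
      Function.update_of_ne (hne m hm) _ _
    refine ⟨Function.update f n w, ?_, ?_, ?_⟩
    · intro m hm
      rcases Finset.mem_insert.1 hm with rfl | hm
      · rwa [Function.update_self]
      · rw [hup m hm, h1 m hm]
    · intro m hm m' hm' hmm
      rw [Finset.mem_insert] at hm hm'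
      rcases hm with rfl | hm <;> rcases hm' with rfl | hm'
      · exact absurd rfl hmm
      · rw [Function.update_self, hup m' hm', ← inner_conj_symm, hworth m' hm', map_zero]
      · rw [Function.update_self, hup m hm, hworth m hm]
      · rw [hup m hm, hup m' hm', h2 m hm m' hm' hmm]
    · intro m hm
      rcases Finset.mem_insert.1 hm with rfl | hm
      · rw [Function.update_self]
        refine le_trans ?_ hV.le
        exact le_iSup_of_le w (le_iSup₂_of_le (hw ▸ Subtype.coe_prop _) hw1 le_rfl)
      · rw [hup m hm]
        exact h3 m hm

lemma minMaxValue_zero_eq_zero {Q : H → ℝ≥0∞} {x : H} (hx : x ≠ 0) (hQ : ∀ a : ℂ, Q (a • x) = 0) :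
    minMaxValue Q 0 = 0 := by
  refine le_antisymm (iInf₂_le_of_le (ℂ ∙ x) (by simpa using finrank_span_singleton hx) ?_) bot_le
  refine iSup_le fun v => iSup₂_le fun hv _ => ?_
  obtain ⟨a, rfl⟩ := Submodule.mem_span_singleton.1 hv
  rw [hQ]

lemma Orthonormal.exists_orthonormalBasis_sum {K : Type*} [NormedAddCommGroup K]
    [InnerProductSpace ℂ K] [FiniteDimensional ℂ K] {κ : Type*} [Fintype κ] {f : κ → K}
    (hf : Orthonormal ℂ f) :
    ∃ (m : ℕ) (b : OrthonormalBasis (κ ⊕ Fin m) ℂ K), ∀ i, b (Sum.inl i) = f i := by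
  have hcard := hf.linearIndependent.fintype_card_le_finrank
  refine ⟨Module.finrank ℂ K - Fintype.card κ, ?_⟩
  have hr : Orthonormal ℂ ((Set.range (Sum.inl : κ → κ ⊕ Fin (Module.finrank ℂ K -
      Fintype.card κ))).domRestrict (Sum.elim f 0)) := by
    refine ⟨?_, ?_⟩
    · rintro ⟨_, i, rfl⟩
      exact hf.1 i
    · rintro ⟨_, i, rfl⟩ ⟨_, j, rfl⟩ hij
      exact hf.2 fun e => hij (by subst e; rfl)
  obtain ⟨b, hb⟩ := hr.exists_orthonormalBasis_extension_of_card_eq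
    (by rw [Fintype.card_sum, Fintype.card_fin]; omega)
  exact ⟨b, fun i => hb _ ⟨i, rfl⟩⟩

end MinMax

/-! ### Concavity for negative exponents. -/

section NegativeExponent

open Filter Topology

variable {H : Type*} [NormedAddCommGroup H] [InnerProductSpace ℂ H] [CompleteSpace H]

/-- Vectors completing the basis have weight `0` and contribute nothing. On `f i`, Young's
functional decreases in the form value and equals `y i ^ (1/p)` at `y i`. -/
lemma sum_rpow_le_sum_youngFun {K κ : Type*} [NormedAddCommGroup K] [InnerProductSpace ℂ K]
    [Fintype κ] {m : ℕ} (b : OrthonormalBasis (κ ⊕ Fin m) ℂ K) {f : κ → K}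
    (hb : ∀ i, b (Sum.inl i) = f i) {p : ℝ} (hp : p < 0) {y : κ → ℝ} (hy : ∀ i, 0 ≤ y i)
    {q : K → ℝ} (hq : ∀ i, q (f i) ≤ y i) :
    ∑ i, y i ^ (1 / p) ≤
      ∑ i, youngFun p (q (b i)) (Sum.elim (fun i => y i ^ (1 / p)) (fun _ => 0) i) := by
  rw [Fintype.sum_sum_type]
  simp only [Sum.elim_inl, Sum.elim_inr, youngFun_zero_right (show p < 1 by linarith),
    Finset.sum_const_zero, add_zero, hb]
  refine Finset.sum_le_sum fun i _ => ?_
  have := youngFun_antitone_of_neg hp (Real.rpow_nonneg (hy i) (1 / p)) (hq i)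
  rwa [youngFun_rpow hp.ne (hy i)] at this

/-- Concavity for finitely many values attained on orthonormal families. -/
lemma combination_sum_rpow_le_negPowTrace {A A₀ A₁ : H →L[ℂ] H} (h₀ : 0 ≤ A₀) (h₁ : 0 ≤ A₁)
    {s t : ℝ} (hs : 0 < s) (ht : 0 < t) (hst : s + t = 1) (hA : A = s • A₀ + t • A₁) {p : ℝ}
    (hp₁ : -1 ≤ p) (hp : p < 0) {B : H →L[ℂ] H} (hB : ∀ x, B x = 0 → x = 0) {κ₀ κ₁ : Type*}
    [Fintype κ₀] [Fintype κ₁] {f₀ : κ₀ → H} {f₁ : κ₁ → H} (o₀ : Orthonormal ℂ f₀)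
    (o₁ : Orthonormal ℂ f₁) {y₀ : κ₀ → ℝ} {y₁ : κ₁ → ℝ} (hy₀ : ∀ i, 0 ≤ y₀ i) (hy₁ : ∀ i, 0 ≤ y₁ i)
    (hQ₀ : ∀ i, negPowForm A₀ p (B (f₀ i)) ≤ ENNReal.ofReal (y₀ i))
    (hQ₁ : ∀ i, negPowForm A₁ p (B (f₁ i)) ≤ ENNReal.ofReal (y₁ i)) :
    ENNReal.ofReal (s * ∑ i, y₀ i ^ (1 / p) + t * ∑ i, y₁ i ^ (1 / p)) ≤
      negPowTrace (fun x => negPowForm A p (B x)) (1 / p) := by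
  have pA : 0 ≤ A := hA ▸ add_nonneg (smul_nonneg hs.le h₀) (smul_nonneg ht.le h₁)
  obtain ⟨K, hK⟩ : ∃ K : Submodule ℂ H, K = Submodule.span ℂ (Set.range f₀ ∪ Set.range f₁) :=
    ⟨_, rfl⟩
  have hKfin : FiniteDimensional ℂ K := by
    rw [hK]
    exact FiniteDimensional.span_of_finite ℂ ((Set.finite_range f₀).union (Set.finite_range f₁))
  obtain ⟨B', hB'⟩ : ∃ B' : K →ₗ[ℂ] H, ∀ v : K, B' v = B v :=
    ⟨B.toLinearMap ∘ₗ K.subtype, fun _ => rfl⟩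
  have hm₀ : ∀ i, f₀ i ∈ K := fun i => hK ▸ Submodule.subset_span (.inl ⟨i, rfl⟩)
  have hm₁ : ∀ i, f₁ i ∈ K := fun i => hK ▸ Submodule.subset_span (.inr ⟨i, rfl⟩)
  have hdom : K ≤ (negPowDomain A p).comap B.toLinearMap := by
    rw [hK, Submodule.span_le]
    rintro _ (⟨i, rfl⟩ | ⟨i, rfl⟩)
    · exact negPowDomain_le h₀ h₁ hs ht.le hst hA hp₁ hp.le
        (mem_negPowDomain.2 (ne_top_of_le_ne_top ENNReal.ofReal_ne_top (hQ₀ i)))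
    · exact negPowDomain_le h₁ h₀ ht hs.le (by rw [add_comm, hst]) (by rw [hA, add_comm]) hp₁ hp.le
        (mem_negPowDomain.2 (ne_top_of_le_ne_top ENNReal.ofReal_ne_top (hQ₁ i)))
  have hfinite : ∀ v : K, negPowForm A p (B' v) ≠ ⊤ := fun v => by
    rw [hB']
    exact mem_negPowDomain.1 (hdom v.2)
  have o₀' : Orthonormal ℂ (fun i => (⟨f₀ i, hm₀ i⟩ : K)) :=
    (K.subtypeₗᵢ.orthonormal_comp_iff).1 o₀
  have o₁' : Orthonormal ℂ (fun i => (⟨f₁ i, hm₁ i⟩ : K)) :=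
    (K.subtypeₗᵢ.orthonormal_comp_iff).1 o₁
  obtain ⟨m₀, b₀, hb₀⟩ := o₀'.exists_orthonormalBasis_sum
  obtain ⟨m₁, b₁, hb₁⟩ := o₁'.exists_orthonormalBasis_sum
  obtain ⟨g, u, hu, -, hconc⟩ := exists_sum_youngFun_concave b₀ b₁ hs.le ht.le
    (u₀ := Sum.elim (fun i => y₀ i ^ (1 / p)) (fun _ => 0))
    (u₁ := Sum.elim (fun i => y₁ i ^ (1 / p)) (fun _ => 0))
    (by rintro (i | i); exacts [Real.rpow_nonneg (hy₀ i) _, le_rfl])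
    (by rintro (i | i); exacts [Real.rpow_nonneg (hy₁ i) _, le_rfl]) H
  -- The completing basis vectors may lie outside the form domains for `A₀` and `A₁`, so concavity
  -- is used for `A + ε`; only the form of `A`, finite on `K`, has to pass to the limit.
  have hreg : ∀ ε : ℝ, 0 < ε → s * ∑ i, y₀ i ^ (1 / p) + t * ∑ i, y₁ i ^ (1 / p) ≤
      ∑ j, youngFun p (regForm A p ε (B' (g j))) (u j) := by
    intro ε hε
    have e : A + ε • (1 : H →L[ℂ] H) = s • (A₀ + ε • (1 : H →L[ℂ] H)) +
        t • (A₁ + ε • (1 : H →L[ℂ] H)) := by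
      rw [hA, smul_add, smul_add, smul_smul, smul_smul, add_add_add_comm, ← add_smul, ← add_mul,
        hst, one_mul]
    have q := isStrictlyPositive_add_smul_one pA hε
    have q₀ := isStrictlyPositive_add_smul_one h₀ hε
    have q₁ := isStrictlyPositive_add_smul_one h₁ hε
    refine le_trans (add_le_add (mul_le_mul_of_nonneg_left ?_ hs.le)
      (mul_le_mul_of_nonneg_left ?_ ht.le)) (hconc B' e hp₁ (by linarith) hp.ne q₀.nonneg q₁.nonneg
        (fun _ => q.isUnit) (fun _ => q₀.isUnit) (fun _ => q₁.isUnit))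
    · refine sum_rpow_le_sum_youngFun b₀ hb₀ hp hy₀ (q := fun v => regForm A₀ p ε (B' v)) fun i => ?_
      rw [hB']
      exact regForm_le_of_negPowForm_le (hy₀ i) (hQ₀ i) hε
    · refine sum_rpow_le_sum_youngFun b₁ hb₁ hp hy₁ (q := fun v => regForm A₁ p ε (B' v)) fun i => ?_
      rw [hB']
      exact regForm_le_of_negPowForm_le (hy₁ i) (hQ₁ i) hε
  have hlim : s * ∑ i, y₀ i ^ (1 / p) + t * ∑ i, y₁ i ^ (1 / p) ≤
      ∑ j, youngFun p (negPowForm A p (B' (g j))).toReal (u j) := by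
    refine ge_of_tendsto (tendsto_finsetSum (x := 𝓝[>] (0 : ℝ))
      (f := fun j ε => youngFun p (regForm A p ε (B' (g j))) (u j)) Finset.univ fun j _ => ?_)
      (eventually_nhdsWithin_of_forall hreg)
    exact ((((tendsto_regForm pA hp₁ hp.le (hfinite (g j))).const_mul _).const_mul _).add_const _)
  obtain ⟨X, hXs, hXQ⟩ := exists_operator_of_negPowForm pA hp₁ hp.le B' hfinite
  obtain ⟨h, x, hanti, -, hX⟩ := exists_eigenbasis hXs fun v => by
    rw [hXQ]; exact ENNReal.toReal_nonneg
  have hx : ∀ k, 0 < x k := by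
    intro k
    have hxk : x k = (negPowForm A p (B' (h k))).toReal := by
      rw [← hXQ, hX, inner_smul_right]
      simp
    rw [hxk]
    -- Injectivity of `B` makes all eigenvalues positive, as Young's inequality for `p < 0`
    -- requires; `ε = 1` already gives a positive lower bound.
    refine (regForm_pos pA one_pos fun h0 => ?_).trans_le
      (regForm_le_toReal (hfinite (h k)) one_pos)
    rw [hB'] at h0
    have h2 : h k = 0 := Subtype.ext (hB _ h0)
    have h1 := h.orthonormal.1 k
    rw [h2, norm_zero] at h1
    exact zero_ne_one h1
  refine le_trans (ENNReal.ofReal_le_ofReal (hlim.trans (sum_youngFun_le_sum_rpow g h (fun j => ?_)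
    fun j k => .inl (youngFun_le_of_neg hp (hx k) (hu j)))))
    (sum_rpow_le_negPowTrace (one_div_neg.2 hp) h hanti hx hX fun v => ?_)
  · rw [← hXQ, re_inner_apply_eq_sum_of_eigenbasis h hX]
  · rw [hXQ, ENNReal.ofReal_toReal (hfinite v), hB']

/-- The line through a kernel vector makes the lowest min-max value `0`, and `0^r = ∞`. -/
lemma negPowTrace_eq_top_of_not_injective (A B : H →L[ℂ] H) (p : ℝ) {r : ℝ} (hr : r < 0) {x : H}
    (hx : x ≠ 0) (hBx : B x = 0) : negPowTrace (fun x => negPowForm A p (B x)) r = ⊤ := by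
  refine ENNReal.tsum_eq_top_of_eq_top ⟨0, ?_⟩
  rw [minMaxValue_zero_eq_zero hx fun a => ?_, ENNReal.zero_rpow_of_neg hr]
  simp [negPowForm, hBx]

omit [CompleteSpace H] in
/-- Partial sums of the trace, with the infinite min-max values left out and the finite ones
increased by `δ`. -/
lemma exists_orthonormal_of_negPowTrace (Q : H → ℝ≥0∞) {r : ℝ} (hr : r < 0) (F : Finset ℕ) {δ : ℝ}
    (hδ : 0 < δ) : ∃ (G : Finset ℕ) (f : G → H) (y : G → ℝ), Orthonormal ℂ f ∧ (∀ i, 0 ≤ y i) ∧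
      (∀ i, Q (f i) ≤ ENNReal.ofReal (y i)) ∧
      ∑ n ∈ F, (minMaxValue Q n + ENNReal.ofReal δ) ^ r = ENNReal.ofReal (∑ i, y i ^ r) := by
  classical
  set G := F.filter fun n => minMaxValue Q n ≠ ⊤ with hG
  have hGt : ∀ n ∈ G, minMaxValue Q n ≠ ⊤ := fun n hn => (Finset.mem_filter.1 hn).2
  -- The shift by `δ` gives the strict inequality needed to find trial vectors, and a positive base
  -- on which real and extended powers agree.
  have hpos : ∀ n, 0 < (minMaxValue Q n).toReal + δ := fun n =>
    add_pos_of_nonneg_of_pos ENNReal.toReal_nonneg hδ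
  have heq : ∀ n ∈ G, ENNReal.ofReal ((minMaxValue Q n).toReal + δ) =
      minMaxValue Q n + ENNReal.ofReal δ := fun n hn => by
    rw [ENNReal.ofReal_add ENNReal.toReal_nonneg hδ.le, ENNReal.ofReal_toReal (hGt n hn)]
  obtain ⟨f, hf, hQ⟩ := exists_orthonormal_le_of_minMaxValue_lt (Q := Q)
    (y := fun n => ENNReal.ofReal ((minMaxValue Q n).toReal + δ)) G fun n hn => by
      rw [heq n hn]
      exact ENNReal.lt_add_right (hGt n hn) (ENNReal.ofReal_pos.2 hδ).ne'
  refine ⟨G, fun i => f i, fun i => (minMaxValue Q i).toReal + δ, hf, fun i => (hpos i).le,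
    fun i => hQ i i.2, ?_⟩
  dsimp only
  rw [ENNReal.ofReal_sum_of_nonneg fun (i : G) _ => Real.rpow_nonneg (hpos i).le r,
    Finset.sum_coe_sort G fun n => ENNReal.ofReal (((minMaxValue Q n).toReal + δ) ^ r),
    ← Finset.sum_subset (Finset.filter_subset (fun n => minMaxValue Q n ≠ ⊤) F)]
  · refine Finset.sum_congr rfl fun n hn => ?_
    rw [← ENNReal.ofReal_rpow_of_pos (hpos n), heq n hn]
  · intro n hn hnG
    have : minMaxValue Q n = ⊤ := by
      by_contra h
      exact hnG (Finset.mem_filter.2 ⟨hn, h⟩)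
    rw [this, top_add, ENNReal.top_rpow_of_neg hr]

omit [CompleteSpace H] in
lemma tendsto_sum_minMaxValue_add (Q : H → ℝ≥0∞) (r : ℝ) (F : Finset ℕ) :
    Tendsto (fun δ : ℝ => ∑ n ∈ F, (minMaxValue Q n + ENNReal.ofReal δ) ^ r) (𝓝[>] 0)
      (𝓝 (∑ n ∈ F, minMaxValue Q n ^ r)) := by
  refine tendsto_finsetSum _ fun n _ => ?_
  refine (ENNReal.continuous_rpow_const.tendsto _).comp ?_
  have h : Tendsto (fun δ : ℝ => ENNReal.ofReal δ) (𝓝[>] 0) (𝓝 0) := by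
    have := (ENNReal.continuous_ofReal.tendsto 0).mono_left (nhdsWithin_le_nhds (s := Set.Ioi 0))
    rwa [ENNReal.ofReal_zero] at this
  simpa using (tendsto_const_nhds (x := minMaxValue Q n)).add h

lemma negPowTrace_concave (B : H →L[ℂ] H) {p : ℝ} (hp₁ : -1 ≤ p) (hp : p < 0)
    {A₀ A₁ : H →L[ℂ] H} (h₀ : 0 ≤ A₀) (h₁ : 0 ≤ A₁) {s t : ℝ} (hs : 0 ≤ s) (ht : 0 ≤ t)
    (hst : s + t = 1) :
    ENNReal.ofReal s * negPowTrace (fun x => negPowForm A₀ p (B x)) (1 / p) +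
      ENNReal.ofReal t * negPowTrace (fun x => negPowForm A₁ p (B x)) (1 / p) ≤
      negPowTrace (fun x => negPowForm (s • A₀ + t • A₁) p (B x)) (1 / p) := by
  rcases hs.eq_or_lt with rfl | hs
  · obtain rfl : t = 1 := by linarith
    simp
  rcases ht.eq_or_lt with rfl | ht
  · obtain rfl : s = 1 := by linarith
    simp
  have hr : 1 / p < 0 := one_div_neg.2 hp
  by_cases hB : ∀ x, B x = 0 → x = 0
  swap
  · push Not at hB
    obtain ⟨x, hBx, hx⟩ := hB
    rw [negPowTrace_eq_top_of_not_injective (s • A₀ + t • A₁) B p hr hx hBx]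
    exact le_top
  obtain ⟨c, hc⟩ : ∃ c, c = negPowTrace (fun x => negPowForm (s • A₀ + t • A₁) p (B x)) (1 / p) :=
    ⟨_, rfl⟩
  rw [← hc]
  unfold negPowTrace
  rw [← ENNReal.tsum_mul_left, ← ENNReal.tsum_mul_left,
    ← ENNReal.summable.tsum_add ENNReal.summable, ENNReal.tsum_eq_iSup_sum]
  refine iSup_le fun F => ?_
  rw [Finset.sum_add_distrib, ← Finset.mul_sum, ← Finset.mul_sum]
  -- It suffices to bound the `δ`-shifted partial sums, which converge by continuity of `x ↦
  -- x^(1/p)` on `[0, ∞]`.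
  refine le_of_tendsto ((ENNReal.Tendsto.const_mul (tendsto_sum_minMaxValue_add _ _ F)
    (.inr ENNReal.ofReal_ne_top)).add (ENNReal.Tendsto.const_mul
      (tendsto_sum_minMaxValue_add _ _ F) (.inr ENNReal.ofReal_ne_top)))
    (eventually_nhdsWithin_of_forall fun δ hδ => ?_)
  obtain ⟨G₀, f₀, y₀, o₀, hy₀, hQ₀, e₀⟩ :=
    exists_orthonormal_of_negPowTrace (fun x => negPowForm A₀ p (B x)) hr F hδ
  obtain ⟨G₁, f₁, y₁, o₁, hy₁, hQ₁, e₁⟩ :=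
    exists_orthonormal_of_negPowTrace (fun x => negPowForm A₁ p (B x)) hr F hδ
  rw [e₀, e₁, ← ENNReal.ofReal_mul hs.le, ← ENNReal.ofReal_mul ht.le, ← ENNReal.ofReal_add
    (mul_nonneg hs.le (Finset.sum_nonneg fun i _ => Real.rpow_nonneg (hy₀ i) _))
    (mul_nonneg ht.le (Finset.sum_nonneg fun i _ => Real.rpow_nonneg (hy₁ i) _)), hc]
  exact combination_sum_rpow_le_negPowTrace h₀ h₁ hs ht hst rfl hp₁ hp hB o₀ o₁ hy₀ hy₁ hQ₀ hQ₁

end NegativeExponent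

theorem lemma5 {H : Type*} [NormedAddCommGroup H] [InnerProductSpace ℂ H] [CompleteSpace H]
    {ι : Type*} (e : HilbertBasis ι ℂ H) (B : H →L[ℂ] H) (p : ℝ)
    (hp_lower : -1 ≤ p) (hp_upper : p ≤ 1) (hp_ne : p ≠ 0) :
    (∀ A₀ A₁ : H →L[ℂ] H, 0 ≤ A₀ → 0 ≤ A₁ → ∀ s t : ℝ, 0 ≤ s → 0 ≤ t → s + t = 1 →
      ENNReal.ofReal s * sandwichTrace e B p A₀ + ENNReal.ofReal t * sandwichTrace e B p A₁
        ≤ sandwichTrace e B p (s • A₀ + t • A₁)) ∧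
    (FiniteDimensional ℂ H →
      ConcaveOn ℝ {A : H →L[ℂ] H | IsStrictlyPositive A} (fun A : H →L[ℂ] H =>
        (LinearMap.trace ℂ H
          (((ContinuousLinearMap.adjoint B * A ^ p * B) ^ (1 / p) : H →L[ℂ] H) :
            H →ₗ[ℂ] H)).re)) := by
  refine ⟨fun A₀ A₁ h₀ h₁ s t hs ht hst => ?_,
    fun _ => concaveOn_re_trace_sandwich B hp_lower hp_upper hp_ne⟩
  unfold sandwichTrace
  rcases lt_or_gt_of_ne hp_ne with hp | hp
  · simp only [if_neg hp.not_gt]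
    exact negPowTrace_concave B hp_lower hp h₀ h₁ hs ht hst
  · simp only [if_pos hp]
    exact posTrace_sandwich_concave e B hp hp_upper h₀ h₁ hs ht hst
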